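/- **Theorem (Completeness of PR2).** Let $T=\langle \mathcal V,s_0,s_*,\mathcal A\rangle$ be a fully observable non-deterministic (FOND) planning task: finitely many variables with finite domains, an initial state $s_0$, a goal condition $s_*$ (a partial state), and finitely many actions $a$, each with a precondition $\mathrm{pre}_a$ (a partial state) and a set $\mathrm{eff}_a$ of outcomes (partial states). If $T$ has a strong cyclic plan, then PR2 finds one: however the choices that the algorithm leaves open are resolved, every run of PR2 on $T$ ends after finitely many steps and returns a policy that is a strong cyclic plan for $T$. *Notation.* $p\oplus q$ is $p$ overwritten by $q$; $p\approx q$ means that $p,q$ agree wherever both are defined. Action $a$ is executable in $s$ if $s\approx \mathrm{pre}_a$, and outcome $o$ leads to $s\oplus o$. A policy is a partial map from states to actions; its execution ends when the goal holds. It is a *strong cyclic plan* if in every non-goal state that it reaches from $s_0$ it prescribes an executable action, and from every state that it reaches it can reach the goal. *Forbidden state-action pairs (FSAPs).* The regression $R(p,a,o)$ has the value $\mathrm{pre}_a(v)$ at $v$ if that is defined, else it is undefined if $p(v)=o(v)$, else it has the value $p(v)$; it is applied only if $p\approx \mathrm{pre}_a\oplus o$. A pair $(ps,a)$ forbids $a$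 in all states consistent with $ps$. To *record* a deadend $s$ means to undefine variables of $s$ one after another, as long as the partial state remains a deadend of the delete relaxation (undefined variables may take any value), until no further one can be undefined, and then to add $(R(de,a,o),a)$ to the FSAPs for the resulting $de$ and all $a$, $o\in\mathrm{eff}_a$ for which the regression applies. *PR2.* The *controller* is a graph. Its nodes carry a condition (partial state), an action, an expected outcome, and a successor for each outcome handled so far; there is also a goal node with condition $s_*$. Each expanded search state has a controller node. A node is marked strong cyclic if no node that has an outcome without successor can be reached from it. After each change, *fixed-point regression* strengthens $ps$ to $ps\oplus R(ps',a,o)$ along the edges (from $ps,a$ via $o$ to $ps'$) until nothing changes. A node *handles* a state if it matches it, is not poisoned, and following expected outcomes from it through matching, unpoisoned nodes gives a loop-free path without forbidden actions to the goal or to an expanded state. Starting with no FSAPs, PR2 repeats rounds until the incumbent solution is detected as strong cyclic, i.e. the controller node of $s_0$ is marked. A round starts with an empty solution and the unhandled search node $s_0$. As long as there are unhandled search nodes, it takes one, with state $s$, and applies the first case that fits: (0) a marked node matches $s$: connect to it; (1) the predecessor is poisoned: skip; (2) $s$ is expanded: connect to its controller node; (3) the predecessor's node is a copy of a node that has an edge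 for this outcome, to a node that handles $s$: overlay a copy of that node and of the path it embodies; (4) some node handles $s$: overlay likewise; (5) a loop-free path with no forbidden actions leads, in the all-outcomes determinization, from $s$ to a state that is expanded or handled by a node (goal states are handled by the goal node), where the search stops: add this weak plan (before that, deadends met by the search may be recorded and the search repeated); (6) otherwise $s$ is a deadend: record it, and poison its predecessor and all descendants of the predecessor, or, if $s=s_0$, stop and return the incumbent's policy. Adding or overlaying a path expands its states and makes their unexpected outcomes unhandled search nodes; no edges are made from or to poisoned nodes. At the end of a round, a solution detected as strong cyclic replaces the incumbent; any other may or may not (comparison of success rates). The policy returned executes, in each state, the action of a matching controller node that is closest to the goal. -/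

import Mathlib

/-!
Fully observable non-deterministic (FOND) planning tasks, strong cyclic plans, and the planner PR2
as a non-deterministic transition system: whatever the algorithm leaves open (order in which search
nodes are processed, which weak plan the classical planner returns, which matching controller node
is used, ...) is a free choice of the step relation.
-/

noncomputable section

namespace FOND

open Classical

universe u v w

/-- Complete states. -/
abbrev State (V : Type u) (D : V → Type v) := (x : V) → D x

/-- Partial states; `none` means that the variable is undefined. -/
abbrev PState (V : Type u) (D : V → Type v) := (x : V) → Option (D x)

/-- A FOND task over the variables `V` with domains `D` and the action names `A`. -/
structure Task (V : Type u) (D : V → Type v) (A : Type w) where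
  init : State V D
  goal : PState V D
  pre : A → PState V D
  eff : A → Set (PState V D)

variable {V : Type u} {D : V → Type v} {A : Type w}

/-- The update `p ⊕ q` of partial states. -/
def upd (p q : PState V D) : PState V D := fun x => if q x ≠ none then q x else p x

/-- The update `s ⊕ o` of a complete state. -/
def app (s : State V D) (o : PState V D) : State V D := fun x => (o x).getD (s x)

/-- A complete state seen as a partial state. -/
def toP (s : State V D) : PState V D := fun x => some (s x)

def Consistent (p q : PState V D) : Prop := ∀ x, p x = none ∨ q x = none ∨ p x = q x

/-- The complete state `s` is consistent with the partial state `p`. -/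
def Sat (s : State V D) (p : PState V D) : Prop := Consistent (toP s) p

namespace Task

variable (T : Task V D A)

/-! ### Policies and strong cyclic plans -/

/-- `s'` can be the next state when the policy `π` is executed in `s`; execution ends once the
goal holds. -/
def PolicyStep (π : State V D → Option A) (s s' : State V D) : Prop :=
  ¬ Sat s T.goal ∧ ∃ a, π s = some a ∧ Sat s (T.pre a) ∧ ∃ o ∈ T.eff a, s' = app s o

/-- `π` is a strong cyclic plan: it is closed (in every state that it reaches from the initial
state and that is not a goal state, it prescribes an executable action), and it is a weak plan for
every state that it reaches. -/
def IsStrongCyclic (π : State V D → Option A) : Prop :=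
  ∀ s, Relation.ReflTransGen (T.PolicyStep π) T.init s →
    (¬ Sat s T.goal → ∃ a, π s = some a ∧ Sat s (T.pre a)) ∧
    ∃ g, Relation.ReflTransGen (T.PolicyStep π) s g ∧ Sat g T.goal

/-! ### Regression, deadends, forbidden state-action pairs -/

/-- Regression of `p` through the action `a` and its outcome `o`. -/
def regr (p : PState V D) (a : A) (o : PState V D) : PState V D := fun x =>
  if T.pre a x ≠ none then T.pre a x
  else if p x = o x then none
  else p x

/-- The pairs of an action and an outcome through which `p` can be regressed: what is known to hold
after the outcome, namely `pre a ⊕ o`, is consistent with `p`. -/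
def canRegr (p : PState V D) : Set (A × PState V D) :=
  {ao | ao.2 ∈ T.eff ao.1 ∧ Consistent p (upd (T.pre ao.1) ao.2)}

/-- The variable-value pairs that are reachable from `p` in the delete relaxation of the all-outcomes
determinization (variables accumulate values); a variable that `p` leaves undefined can have any
value. -/
inductive Relaxed (p : PState V D) : (x : V) → D x → Prop
  | undef (x : V) (d : D x) : p x = none → Relaxed p x d
  | start (x : V) (d : D x) : p x = some d → Relaxed p x d
  | act (a : A) (o : PState V D) (x : V) (d : D x) :
      (∀ y e, T.pre a y = some e → Relaxed p y e) → o ∈ T.eff a → o x = some d → Relaxed p x d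

def RelaxedDeadend (p : PState V D) : Prop :=
  ¬ ∀ x d, T.goal x = some d → T.Relaxed p x d

/-- One variable is relaxed, and a delete-relaxed deadend remains. -/
def RelaxVar (p p' : PState V D) : Prop :=
  ∃ x, p x ≠ none ∧ p' = Function.update p x none ∧ T.RelaxedDeadend p'

/-- `de` is a generalization of the deadend `s`: variables are relaxed progressively, as long as
a delete-relaxed deadend remains. -/
def Generalizes (s : State V D) (de : PState V D) : Prop :=
  Relation.ReflTransGen T.RelaxVar (toP s) de ∧ ∀ p', ¬ T.RelaxVar de p'

/-- The forbidden state-action pairs obtained from the generalized deadend `de`. -/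
def fsaps (de : PState V D) : Set (PState V D × A) :=
  {f | ∃ ao ∈ T.canRegr de, f = (T.regr de ao.1 ao.2, ao.1)}

end Task

/-- The FSAPs in `F` forbid the action `a` in the state `s`. -/
def Forbidden (F : Set (PState V D × A)) (s : State V D) (a : A) : Prop :=
  ∃ ps, (ps, a) ∈ F ∧ Sat s ps

/-! ### Controller and Reachable -/

/-- Reference to a node of the controller: the goal node, or the node that was created for the
search state `n`. -/
inductive Ref (V : Type u) (D : V → Type v)
  | goal : Ref V D
  | node (n : State V D) : Ref V D

/-- A node of the controller other than the goal node. Its list of predecessors and its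
strong cyclic flag are determined by the graph, see `StrongCyclicMark`. -/
structure SolStep (V : Type u) (D : V → Type v) (A : Type w) where
  /-- the condition under which the step applies -/
  ps : PState V D
  act : A
  /-- the outcome chosen by the weak plan in the all-outcomes determinization -/
  exp : PState V D
  /-- the successor for each outcome, `none` as long as there is none -/
  out : PState V D → Option (Ref V D)
  /-- the step of which this one was made a copy, if any -/
  orig : Option (State V D)

/-- A search node that is still to be handled: the initial state (`none`), or what the outcome `o`
of the action chosen in the state `m` leads to (`some (m, o)`). -/
abbrev Entry (V : Type u) (D : V → Type v) := Option (State V D × PState V D)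

/-- A partial solution. The expanded nodes of Reachable are the states `n` with `ctrl n ≠ none`;
`ctrl n` is the controller node associated with `n`. -/
structure Solution (V : Type u) (D : V → Type v) (A : Type w) where
  ctrl : State V D → Option (SolStep V D A)
  /-- the controller node associated with the initial state -/
  root : Option (Ref V D)
  /-- the nodes of Reachable that are not handled yet -/
  pending : Set (Entry V D)
  poisoned : Set (State V D)

/-- The empty solution for the given set of search nodes. -/
def emptySol (E : Set (Entry V D)) : Solution V D A :=
  ⟨fun _ => none, none, E, ∅⟩

/-- One step of a weak plan: in `state`, the action `act` is applied and its outcome `outc` is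
chosen; `orig` tells of which controller node the step is a copy. -/
structure PlanStep (V : Type u) (D : V → Type v) (A : Type w) where
  state : State V D
  act : A
  outc : PState V D
  orig : Option (State V D)

namespace Task

variable (T : Task V D A)

/-- The state of a search node. -/
def entryState : Entry V D → State V D
  | none => T.init
  | some (m, o) => app m o

/-- The condition of a controller node. -/
def cond (σ : Solution V D A) : Ref V D → Option (PState V D)
  | .goal => some T.goal
  | .node n => (σ.ctrl n).map SolStep.ps

/-- The action of a controller node (none for the goal node). -/
def refAct (σ : Solution V D A) : Ref V D → Option A
  | .goal => none
  | .node n => (σ.ctrl n).map SolStep.act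

/-- The controller node `r` matches the complete state `s`. -/
def Matches (σ : Solution V D A) (r : Ref V D) (s : State V D) : Prop :=
  ∃ p, T.cond σ r = some p ∧ Sat s p

/-- The node or the search state it belongs to has been poisoned. -/
def IsPoisoned (σ : Solution V D A) : Ref V D → Prop
  | .goal => False
  | .node n => n ∈ σ.poisoned

/-- Complement of the strong cyclic marking: the nodes with an unhandled outcome, and backwards all
nodes from which such a node can be reached. -/
inductive NotSC (σ : Solution V D A) : Ref V D → Prop
  | unhandled (n : State V D) (ss : SolStep V D A) (o : PState V D) :
      σ.ctrl n = some ss → o ∈ T.eff ss.act → ss.out o = none → NotSC σ (.node n)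
  | pred (n : State V D) (ss : SolStep V D A) (o : PState V D) (r : Ref V D) :
      σ.ctrl n = some ss → ss.out o = some r → NotSC σ r → NotSC σ (.node n)

/-- The strong cyclic marking of the nodes of the controller. -/
def StrongCyclicMark (σ : Solution V D A) (r : Ref V D) : Prop :=
  (T.cond σ r).isSome ∧ ¬ T.NotSC σ r

/-- The solution is detected as strong cyclic: the node of the initial state is marked. -/
def DetectedSC (σ : Solution V D A) : Prop :=
  ∃ r, σ.root = some r ∧ T.StrongCyclicMark σ r

/-! ### Updating the controller -/

/-- A new edge from the node of `m` along the outcome `o` to `r`; nothing happens if one of the two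
nodes is poisoned. -/
def link (σ : Solution V D A) (m : State V D) (o : PState V D) (r : Ref V D) : Solution V D A :=
  if m ∈ σ.poisoned ∨ IsPoisoned σ r then σ
  else { σ with
    ctrl := Function.update σ.ctrl m
      ((σ.ctrl m).map fun ss => { ss with out := Function.update ss.out o (some r) }) }

/-- Connects the predecessor of a search node with the controller node `r`. -/
def attach (σ : Solution V D A) (e : Entry V D) (r : Ref V D) : Solution V D A :=
  match e with
  | none => { σ with root := some r }
  | some (m, o) => link σ m o r

/-- One update of the fixed-point regression: for some edge of the controller, the condition of its
source is strengthened to the combined regression of the condition of its target. -/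
def FprStep (σ σ' : Solution V D A) : Prop :=
  ∃ n ss o r p, σ.ctrl n = some ss ∧ ss.out o = some r ∧ T.cond σ r = some p ∧
    n ∉ σ.poisoned ∧ ¬ IsPoisoned σ r ∧
    upd ss.ps (T.regr p ss.act o) ≠ ss.ps ∧
    σ' = { σ with
      ctrl := Function.update σ.ctrl n
        (some { ss with ps := upd ss.ps (T.regr p ss.act o) }) }

/-- Fixed-point regression: updates are propagated until no further one is made. -/
def Fpr (σ σ' : Solution V D A) : Prop :=
  Relation.ReflTransGen T.FprStep σ σ' ∧ ∀ τ, ¬ T.FprStep σ' τ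

/-- The first controller node of a plan that is continued at `r`. -/
def firstRef (l : List (PlanStep V D A)) (r : Ref V D) : Ref V D :=
  match l with
  | [] => r
  | st :: _ => .node st.state

/-- Adds the states of a weak plan to Reachable, with a new controller node for each of them; the
plan is continued at the controller node `r`. The outcomes that are not the expected ones become
unhandled search nodes. -/
def addPlan (σ : Solution V D A) : List (PlanStep V D A) → Ref V D → Solution V D A
  | [], _ => σ
  | st :: l, r =>
      let τ := addPlan σ l r
      link
        { τ with
          ctrl := Function.update τ.ctrl st.state
            (some ⟨T.pre st.act, st.act, st.outc, fun _ => none, st.orig⟩)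
          pending := τ.pending ∪
            {e | ∃ o ∈ T.eff st.act, o ≠ st.outc ∧ e = some (st.state, o)} }
        st.state st.outc (firstRef l r)

/-! ### Weak plans -/

/-- The weak plan that the controller embodies, followed from the node `r` in the state `s` along
the expected outcomes through nodes that match and are not poisoned, without using a forbidden
action: it ends at the goal or at the first state
that is already expanded, and `t` is the controller node there. -/
inductive Follows (F : Set (PState V D × A)) (σ : Solution V D A) :
    Ref V D → State V D → List (PlanStep V D A) → Ref V D → Prop
  | goal (r : Ref V D) (s : State V D) : Sat s T.goal → Follows F σ r s [] .goal
  | known (r : Ref V D) (s : State V D) : ¬ Sat s T.goal → σ.ctrl s ≠ none →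
      Follows F σ r s [] (.node s)
  | step (n s : State V D) (ss : SolStep V D A) (r t : Ref V D) (l : List (PlanStep V D A)) :
      ¬ Sat s T.goal → σ.ctrl s = none → σ.ctrl n = some ss → n ∉ σ.poisoned → Sat s ss.ps →
      Sat s (T.pre ss.act) → ¬ Forbidden F s ss.act → ss.out ss.exp = some r → Follows F σ r (app s ss.exp) l t →
      Follows F σ (.node n) s (⟨s, ss.act, ss.exp, some n⟩ :: l) t

/-- The controller node `r` can handle the state `s`: `r` matches `s`, is not poisoned, and the weak
plan `l` (continued at `t`) that it embodies from `s` uses no forbidden action and is loop-free. -/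
def Handles (F : Set (PState V D × A)) (σ : Solution V D A) (r : Ref V D) (s : State V D)
    (l : List (PlanStep V D A)) (t : Ref V D) : Prop :=
  T.Matches σ r s ∧ ¬ IsPoisoned σ r ∧ T.Follows F σ r s l t ∧ (l.map PlanStep.state).Nodup

/-- The search for a weak plan stops in the state `s`: it is already expanded, or some node of the
controller (possibly the goal node) handles it. -/
def Stops (F : Set (PState V D × A)) (σ : Solution V D A) (s : State V D)
    (l : List (PlanStep V D A)) (t : Ref V D) : Prop :=
  (σ.ctrl s ≠ none ∧ l = [] ∧ t = .node s) ∨ ∃ r, T.Handles F σ r s l t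

/-- A path of the all-outcomes determinization that avoids the FSAPs and does not go beyond a state
where the search stops. -/
inductive Search (F : Set (PState V D × A)) (σ : Solution V D A) :
    State V D → List (PlanStep V D A) → State V D → Prop
  | nil (s : State V D) : Search F σ s [] s
  | cons (s e : State V D) (a : A) (o : PState V D) (l : List (PlanStep V D A)) :
      (¬ ∃ l' t, T.Stops F σ s l' t) → Sat s (T.pre a) → ¬ Forbidden F s a → o ∈ T.eff a →
      Search F σ (app s o) l e → Search F σ s (⟨s, a, o, none⟩ :: l) e

/-- `l` is a (loop-free) weak plan from `s`, as found by a classical planner in the all-outcomes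
determinization with FSAPs avoided; it is continued at the controller node `t`. -/
def WeakPlan (F : Set (PState V D × A)) (σ : Solution V D A) (s : State V D)
    (l : List (PlanStep V D A)) (t : Ref V D) : Prop :=
  ∃ l₁ l₂ e, T.Search F σ s l₁ e ∧ (l₁.map PlanStep.state).Nodup ∧ T.Stops F σ e l₂ t ∧
    l = l₁ ++ l₂

/-- No weak plan is found from `s`. -/
def Deadend (F : Set (PState V D × A)) (σ : Solution V D A) (s : State V D) : Prop :=
  ¬ ∃ l t, T.WeakPlan F σ s l t

/-- One step of the all-outcomes determinization with FSAPs avoided. -/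
def DetStep (F : Set (PState V D × A)) (s s' : State V D) : Prop :=
  ∃ a, Sat s (T.pre a) ∧ ¬ Forbidden F s a ∧ ∃ o ∈ T.eff a, s' = app s o

/-! ### The cases for handling a search node -/

/-- Case 0: a strong cyclic node `r` of the controller handles the search node. -/
def Case0 (σ : Solution V D A) (e : Entry V D) (r : Ref V D) : Prop :=
  T.StrongCyclicMark σ r ∧ T.Matches σ r (T.entryState e)

/-- Case 1: the predecessor of the search node, and hence the search node, is poisoned. -/
def Case1 (σ : Solution V D A) (e : Entry V D) : Prop :=
  ∃ m o, e = some (m, o) ∧ m ∈ σ.poisoned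

/-- Case 2: the state of the search node is already expanded. -/
def Case2 (σ : Solution V D A) (e : Entry V D) : Prop :=
  σ.ctrl (T.entryState e) ≠ none

/-- Case 3: there is a predefined path, since the controller node of which the predecessor's node is
a copy has an edge for the outcome. -/
def Case3 (F : Set (PState V D × A)) (σ : Solution V D A) (e : Entry V D)
    (l : List (PlanStep V D A)) (t : Ref V D) : Prop :=
  ∃ m o ss n ss' r, e = some (m, o) ∧ σ.ctrl m = some ss ∧ ss.orig = some n ∧
    σ.ctrl n = some ss' ∧ ss'.out o = some r ∧ T.Handles F σ r (T.entryState e) l t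

/-- Case 4: some node of the controller handles the state of the search node. -/
def Case4 (F : Set (PState V D × A)) (σ : Solution V D A) (e : Entry V D)
    (l : List (PlanStep V D A)) (t : Ref V D) : Prop :=
  ∃ r, T.Handles F σ r (T.entryState e) l t

/-- Case 5: a new weak plan is found. -/
def Case5 (F : Set (PState V D × A)) (σ : Solution V D A) (e : Entry V D)
    (l : List (PlanStep V D A)) (t : Ref V D) : Prop :=
  T.WeakPlan F σ (T.entryState e) l t

/-- None of the cases 0, 1, 2 applies. -/
def Not012 (σ : Solution V D A) (e : Entry V D) : Prop :=
  (¬ ∃ r, T.Case0 σ e r) ∧ ¬ Case1 σ e ∧ ¬ T.Case2 σ e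

/-- None of the cases 0, ..., 4 applies. -/
def Not01234 (F : Set (PState V D × A)) (σ : Solution V D A) (e : Entry V D) : Prop :=
  T.Not012 σ e ∧ (¬ ∃ l t, T.Case3 F σ e l t) ∧ ¬ ∃ l t, T.Case4 F σ e l t

/-- The search node `e` is removed from the unhandled nodes. -/
def pop (σ : Solution V D A) (e : Entry V D) : Solution V D A :=
  { σ with pending := σ.pending \ {e} }

/-- A weak plan for the search node `e` is added to the solution. -/
def hookPlan (σ : Solution V D A) (e : Entry V D) (l : List (PlanStep V D A)) (t : Ref V D) :
    Solution V D A :=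
  attach (T.addPlan (pop σ e) l t) e (firstRef l t)

/-- The state `n'` is a child of `n`. -/
def Child (σ : Solution V D A) (n n' : State V D) : Prop :=
  ∃ ss o, σ.ctrl n = some ss ∧ ss.out o = some (.node n')

/-- The predecessor of a deadend and all descendants of the predecessor are poisoned. -/
def poison (σ : Solution V D A) (e : Entry V D) : Solution V D A :=
  { σ with poisoned := σ.poisoned ∪
      {n | ∃ m o, e = some (m, o) ∧ Relation.ReflTransGen (Child σ) m n} }

/-- One iteration of the inner loop for the unhandled search node `e`, from FSAPs `F` and solution
`σ` to `F'` and `σ'`; the cases are tried in the given order. -/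
inductive Handle (e : Entry V D) :
    Set (PState V D × A) → Solution V D A → Set (PState V D × A) → Solution V D A → Prop
  | case0 (F : Set (PState V D × A)) (σ σ' : Solution V D A) (r : Ref V D) :
      T.Case0 σ e r → T.Fpr (attach (pop σ e) e r) σ' → Handle e F σ F σ'
  | case1 (F : Set (PState V D × A)) (σ : Solution V D A) :
      (¬ ∃ r, T.Case0 σ e r) → Case1 σ e → Handle e F σ F (pop σ e)
  | case2 (F : Set (PState V D × A)) (σ σ' : Solution V D A) :
      (¬ ∃ r, T.Case0 σ e r) → ¬ Case1 σ e → T.Case2 σ e →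
      T.Fpr (attach (pop σ e) e (.node (T.entryState e))) σ' → Handle e F σ F σ'
  | case3 (F : Set (PState V D × A)) (σ σ' : Solution V D A) (l : List (PlanStep V D A))
      (t : Ref V D) :
      T.Not012 σ e → T.Case3 F σ e l t → T.Fpr (T.hookPlan σ e l t) σ' → Handle e F σ F σ'
  | case4 (F : Set (PState V D × A)) (σ σ' : Solution V D A) (l : List (PlanStep V D A))
      (t : Ref V D) :
      T.Not012 σ e → (¬ ∃ l t, T.Case3 F σ e l t) → T.Case4 F σ e l t →
      T.Fpr (T.hookPlan σ e l t) σ' → Handle e F σ F σ'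
  | case5 (F : Set (PState V D × A)) (σ σ' : Solution V D A) (l : List (PlanStep V D A))
      (t : Ref V D) :
      T.Not01234 F σ e → T.Case5 F σ e l t → T.Fpr (T.hookPlan σ e l t) σ' → Handle e F σ F σ'
  /-- In case 5, a deadend `x` that is met by the weak planning procedure, or that the plan found
  could run into, may be recorded; weak planning is then run again. -/
  | record (F : Set (PState V D × A)) (σ : Solution V D A) (x : State V D) (de : PState V D) :
      T.Not01234 F σ e → (∃ l t, T.Case5 F σ e l t) →
      Relation.ReflTransGen (T.DetStep F) (T.entryState e) x → T.Deadend F σ x →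
      T.Generalizes x de → ¬ T.fsaps de ⊆ F → Handle e F σ (F ∪ T.fsaps de) σ
  | case6 (F : Set (PState V D × A)) (σ : Solution V D A) (de : PState V D) :
      T.Not01234 F σ e → T.Deadend F σ (T.entryState e) → T.Generalizes (T.entryState e) de →
      Handle e F σ (F ∪ T.fsaps de) (poison (pop σ e) e)

/-- The search node `e` falls under case 6. -/
def Case6 (F : Set (PState V D × A)) (σ : Solution V D A) (e : Entry V D) : Prop :=
  T.Not01234 F σ e ∧ T.Deadend F σ (T.entryState e)

/-! ### The policy of a controller -/

/-- There is a path of length `k` in the controller from the given node to the goal node. -/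
inductive GoalIn (σ : Solution V D A) : Ref V D → ℕ → Prop
  | zero : GoalIn σ .goal 0
  | succ (n : State V D) (ss : SolStep V D A) (o : PState V D) (r : Ref V D) (k : ℕ) :
      σ.ctrl n = some ss → ss.out o = some r → GoalIn σ r k → GoalIn σ (.node n) (k + 1)

/-- `r` is a node closest to the goal among the nodes of the controller that match `s`. -/
def Closest (σ : Solution V D A) (s : State V D) (r : Ref V D) : Prop :=
  T.Matches σ r s ∧ ∀ r' k', T.Matches σ r' s → GoalIn σ r' k' → ∃ k ≤ k', GoalIn σ r k

/-- `π` is a policy obtained from the controller: it executes the action of a matching node that is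
closest to the goal. -/
def IsPolicyOf (σ : Solution V D A) (π : State V D → Option A) : Prop :=
  ∀ s, (∃ r, T.Closest σ s r ∧ π s = refAct σ r) ∨ ((∀ r, ¬ T.Matches σ r s) ∧ π s = none)

end Task

/-! ### The planner -/

/-- Configurations of the planner: at the head of the outer loop, in the inner loop, terminated. -/
inductive Config (V : Type u) (D : V → Type v) (A : Type w)
  | outer (incumbent : Solution V D A) (F : Set (PState V D × A))
  | inner (incumbent : Solution V D A) (F : Set (PState V D × A)) (sol : Solution V D A)
  | done (π : State V D → Option A)

namespace Task

variable (T : Task V D A)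

/-- The initial configuration: an empty incumbent and no FSAPs. -/
def start : Config V D A := .outer (emptySol ∅) ∅

/-- The transitions of PR2. -/
inductive PR2Step : Config V D A → Config V D A → Prop
  | finish (inc : Solution V D A) (F : Set (PState V D × A)) (π : State V D → Option A) :
      T.DetectedSC inc → T.IsPolicyOf inc π → PR2Step (.outer inc F) (.done π)
  | round (inc : Solution V D A) (F : Set (PState V D × A)) :
      ¬ T.DetectedSC inc → PR2Step (.outer inc F) (.inner inc F (emptySol {none}))
  | handle (inc σ σ' : Solution V D A) (F F' : Set (PState V D × A)) (e : Entry V D) :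
      e ∈ σ.pending → T.Handle e F σ F' σ' →
      ¬ (T.Case6 F σ e ∧ T.entryState e = T.init) →
      PR2Step (.inner inc F σ) (.inner inc F' σ')
  /-- The initial state itself is a deadend. -/
  | fail (inc σ : Solution V D A) (F : Set (PState V D × A)) (e : Entry V D)
      (π : State V D → Option A) :
      e ∈ σ.pending → T.Case6 F σ e → T.entryState e = T.init → T.IsPolicyOf inc π →
      PR2Step (.inner inc F σ) (.done π)
  /-- A solution that is detected as strong cyclic has the maximal success rate, so it becomes the
  incumbent. -/
  | accept (inc σ : Solution V D A) (F : Set (PState V D × A)) :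
      σ.pending = ∅ → T.DetectedSC σ → PR2Step (.inner inc F σ) (.outer σ F)
  /-- Otherwise the result of comparing the success rates is left open. -/
  | replace (inc σ : Solution V D A) (F : Set (PState V D × A)) :
      σ.pending = ∅ → ¬ T.DetectedSC σ → PR2Step (.inner inc F σ) (.outer σ F)
  | keep (inc σ : Solution V D A) (F : Set (PState V D × A)) :
      σ.pending = ∅ → ¬ T.DetectedSC σ → PR2Step (.inner inc F σ) (.outer inc F)

end Task

end FOND

end

/-!
Let `π` be a strong cyclic plan of the task. The proof rests on three observations.

*Forbidden pairs are sound* (`Sound`). In a state that `π` reaches before the goal, the action of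
`π` is never forbidden. Indeed, from every state reached by `π` the goal can be reached by actions
that are not forbidden, so that no such state is ever a deadend (`not_deadend`), nor is it covered
by a generalized one (`not_relaxedDeadend`); and a recorded pair forbids an action only where one of
its outcomes leads to a state covered by a generalized deadend (`Sound.union_fsaps`). In particular
the initial state never falls under case 6.

*The controller stays consistent* (`Inv`). The condition of each node holds in the state that the
node was created for, and each edge leads to a node that matches the resulting state. The only edges
that do not lead to the node of that state itself, or to the goal node, are those of case 0. They
lead to nodes that are marked strong cyclic; nothing new becomes reachable from such a node, so its
condition, which is closed under regression, never changes again. Hence regressed conditions never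
contradict each other, fixed-point regression only ever defines further variables, and it terminates
(`exists_fpr`). Controller and conditions change one node at a time, treated in `Core.update`. If a
solution is detected as strong cyclic, every node is marked, as all nodes are reachable from the
node of the initial state, and nothing is poisoned, as poisoning loses an outcome for good. Then the
conditions are closed under regression along all outcomes, which makes the policy of the controller
strong cyclic (`Inv.isStrongCyclic`).

*Each round is successful or records a new forbidden pair.* Within a round, while the set of
forbidden pairs stays the same, each iteration expands a state or removes a search node
(`Handle.progress`). If that set does not change at all during a round, then every action of the
controller is allowed by it (`Clean`). A deadend under case 6 would make the action leading to it
forbidden (`forbidden_fsaps`), so that there is none; all outcomes are then handled, and the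
solution is detected. Since there are finitely many pairs, this gives a termination measure
(`rank`).
-/

namespace FOND

open Classical

universe u v w

variable {V : Type u} {D : V → Type v} {A : Type w}

/-! ### Partial states and regression -/

theorem sat_iff {s : State V D} {p : PState V D} :
    Sat s p ↔ ∀ x d, p x = some d → s x = d := by
  unfold Sat Consistent toP
  constructor
  · intro h x d hd
    have := h x
    simp_all
  · intro h x
    cases hp : p x with
    | none => simp
    | some d => simp [h x d hp]

theorem sat_toP_self (s : State V D) : Sat s (toP s) := by
  rw [sat_iff]
  intro x d h
  simpa [toP] using h

theorem eq_of_sat_toP {s t : State V D} (h : Sat t (toP s)) : t = s :=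
  funext fun x => sat_iff.1 h x (s x) rfl

theorem app_of_some {s : State V D} {o : PState V D} {x : V} {d : D x} (h : o x = some d) :
    app s o x = d := by
  simp [app, h]

theorem app_of_none {s : State V D} {o : PState V D} {x : V} (h : o x = none) :
    app s o x = s x := by
  simp [app, h]

theorem Sat.upd {s : State V D} {p q : PState V D} (hp : Sat s p) (hq : Sat s q) :
    Sat s (upd p q) := by
  rw [sat_iff] at *
  intro x d h
  unfold FOND.upd at h
  split_ifs at h
  · exact hq x d h
  · exact hp x d h

theorem Sat.of_upd_right {s : State V D} {p q : PState V D} (h : Sat s (FOND.upd p q)) :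
    Sat s q := by
  rw [sat_iff] at *
  intro x d hq
  apply h
  simp [FOND.upd, hq]

namespace Task

variable (T : Task V D A)

theorem sat_regr {s : State V D} {p o : PState V D} {a : A} (hpre : Sat s (T.pre a))
    (hp : Sat (app s o) p) : Sat s (T.regr p a o) := by
  rw [sat_iff] at *
  intro x d h
  unfold regr at h
  split_ifs at h with h1 h2
  · exact hpre x d h
  · have hpx := hp x d h
    cases ho : o x with
    | none => rwa [app_of_none ho] at hpx
    | some d' =>
      rw [app_of_some ho] at hpx
      exact absurd (by rw [h, ho, hpx]) h2

theorem sat_pre_of_sat_regr {s : State V D} {p o : PState V D} {a : A}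
    (h : Sat s (T.regr p a o)) : Sat s (T.pre a) := by
  rw [sat_iff] at *
  intro x d hx
  apply h
  simp [regr, hx]

/-- Regression is sufficient: the outcome leads from a state that satisfies the regressed condition
to one that satisfies `p`, provided that the regression applies. -/
theorem sat_app_of_sat_regr {s : State V D} {p o : PState V D} {a : A}
    (hc : Consistent p (upd (T.pre a) o)) (h : Sat s (T.regr p a o)) : Sat (app s o) p := by
  rw [sat_iff] at *
  intro x d hx
  have hcx := hc x
  have hsx := h x
  unfold upd at hcx
  unfold regr at hsx
  cases ho : o x with
  | some d' =>
    rw [app_of_some ho]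
    simp_all
  | none =>
    rw [app_of_none ho]
    simp only [ho, hx] at hcx hsx
    cases hq : T.pre a x with
    | none => simp_all
    | some d' =>
      simp only [hq] at hcx hsx
      simp_all

theorem consistent_of_sat_app {s : State V D} {p o : PState V D} {a : A}
    (hpre : Sat s (T.pre a)) (hp : Sat (app s o) p) : Consistent p (upd (T.pre a) o) := by
  rw [sat_iff] at *
  intro x
  cases hx : p x with
  | none => exact .inl rfl
  | some d =>
    refine .inr ?_
    have hpx := hp x d hx
    unfold upd
    cases ho : o x with
    | some d' =>
      rw [app_of_some ho] at hpx
      simp [hpx]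
    | none =>
      rw [app_of_none ho] at hpx
      cases hq : T.pre a x with
      | none => simp
      | some d' => simp [← hpre x d' hq, hpx]

/-- The recorded pairs forbid every transition into a state covered by the generalized deadend. -/
theorem forbidden_fsaps {s : State V D} {o de : PState V D} {a : A} (hpre : Sat s (T.pre a))
    (ho : o ∈ T.eff a) (hde : Sat (app s o) de) : Forbidden (T.fsaps de) s a :=
  ⟨T.regr de a o, ⟨(a, o), ⟨ho, T.consistent_of_sat_app hpre hde⟩, rfl⟩, T.sat_regr hpre hde⟩

/-! ### Soundness of deadends and forbidden pairs -/

/-- The delete relaxation reaches all values that occur in a reachable state. -/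
theorem relaxed_of_reaches {π : State V D → Option A} {s g : State V D} {p : PState V D}
    (hs : Sat s p) (h : Relation.ReflTransGen (T.PolicyStep π) s g) (x : V) :
    T.Relaxed p x (g x) := by
  induction h generalizing x with
  | refl =>
    cases hp : p x with
    | none => exact .undef x _ hp
    | some d => exact .start x _ (by rw [hp, sat_iff.1 hs x d hp])
  | @tail b c _ hstep ih =>
    obtain ⟨-, a, -, hpre, o, ho, rfl⟩ := hstep
    cases hox : o x with
    | none => rw [app_of_none hox]; exact ih x
    | some d =>
      rw [app_of_some hox]
      exact .act a o x d (fun y e hy => sat_iff.1 hpre y e hy ▸ ih y) ho hox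

theorem not_relaxedDeadend {π : State V D → Option A} {s g : State V D} {p : PState V D}
    (hs : Sat s p) (h : Relation.ReflTransGen (T.PolicyStep π) s g) (hg : Sat g T.goal) :
    ¬ T.RelaxedDeadend p :=
  fun hd => hd fun x d hx => sat_iff.1 hg x d hx ▸ T.relaxed_of_reaches hs h x

theorem Generalizes.eq_or_relaxedDeadend {T : Task V D A} {s : State V D} {de : PState V D}
    (h : T.Generalizes s de) : de = toP s ∨ T.RelaxedDeadend de := by
  rcases Relation.ReflTransGen.cases_tail h.1 with h | ⟨_, _, _, _, _, h⟩
  · exact .inl h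
  · exact .inr h

theorem Generalizes.sat {T : Task V D A} {s : State V D} {de : PState V D}
    (h : T.Generalizes s de) : Sat s de := by
  obtain ⟨h, -⟩ := h
  induction h with
  | refl => exact sat_toP_self s
  | tail _ hstep ih =>
    obtain ⟨x, -, rfl, -⟩ := hstep
    rw [sat_iff] at *
    intro y d hy
    by_cases hxy : y = x
    · subst hxy
      simp at hy
    · rw [Function.update_of_ne hxy] at hy
      exact ih y d hy

/-- The forbidden pairs are sound for a policy if they never forbid an action that the policy
executes before the goal holds. -/
def Sound (π : State V D → Option A) (F : Set (PState V D × A)) : Prop :=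
  ∀ s, Relation.ReflTransGen (T.PolicyStep π) T.init s → ¬ Sat s T.goal →
    ∀ a, π s = some a → ¬ Forbidden F s a

theorem Search.exists_suffix {T : Task V D A} {F : Set (PState V D × A)} {σ : Solution V D A}
    {s e x : State V D} {l : List (PlanStep V D A)} (h : T.Search F σ s l e)
    (hx : x ∈ l.map PlanStep.state) : ∃ l', T.Search F σ x l' e ∧ l' <:+ l := by
  induction h with
  | nil => simp at hx
  | cons s e a o l h1 h2 h3 h4 h5 ih =>
    rw [List.map_cons, List.mem_cons] at hx
    rcases hx with rfl | hx
    · exact ⟨_, .cons _ e a o l h1 h2 h3 h4 h5, List.suffix_refl _⟩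
    · obtain ⟨l', hl, hs⟩ := ih hx
      exact ⟨l', hl, hs.trans (List.suffix_cons _ _)⟩

theorem stops_of_sat_goal (F : Set (PState V D × A)) (σ : Solution V D A) {s : State V D}
    (h : Sat s T.goal) : T.Stops F σ s [] .goal :=
  .inr ⟨.goal, ⟨_, rfl, h⟩, id, .goal _ _ h, List.nodup_nil⟩

theorem not_deadend {π : State V D → Option A} {F : Set (PState V D × A)} (σ : Solution V D A)
    (hF : T.Sound π F) {s g : State V D}
    (hs : Relation.ReflTransGen (T.PolicyStep π) T.init s)
    (hg : Relation.ReflTransGen (T.PolicyStep π) s g) (hgoal : Sat g T.goal) :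
    ¬ T.Deadend F σ s := by
  suffices h : ∃ l₁ l₂ t e, T.Search F σ s l₁ e ∧ (l₁.map PlanStep.state).Nodup ∧
      T.Stops F σ e l₂ t by
    obtain ⟨l₁, l₂, t, e, h1, h2, h3⟩ := h
    exact fun hd => hd ⟨_, t, l₁, l₂, e, h1, h2, h3, rfl⟩
  induction hg using Relation.ReflTransGen.head_induction_on with
  | refl => exact ⟨[], [], _, g, .nil g, by simp, T.stops_of_sat_goal F σ hgoal⟩
  | @head s s' hstep _ ih =>
    by_cases hhalt : ∃ l' t, T.Stops F σ s l' t
    · obtain ⟨l', t, h⟩ := hhalt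
      exact ⟨[], l', t, s, .nil s, by simp, h⟩
    obtain ⟨l₁, l₂, t, e, h1, h2, h3⟩ := ih (hs.tail hstep)
    obtain ⟨hng, a, ha, hpre, o, ho, rfl⟩ := hstep
    -- If the path returns to `s`, its part from that visit on is loop-free already.
    by_cases hmem : s ∈ l₁.map PlanStep.state
    · obtain ⟨l', hl', hsuf⟩ := h1.exists_suffix hmem
      exact ⟨l', l₂, t, e, hl', h2.sublist (hsuf.sublist.map _), h3⟩
    · exact ⟨_, l₂, t, e, .cons s e a o l₁ hhalt hpre (hF s hs hng a ha) ho h1,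
        List.nodup_cons.2 ⟨hmem, h2⟩, h3⟩

theorem Sound.union_fsaps {T : Task V D A} {π : State V D → Option A}
    {F : Set (PState V D × A)} (hπ : T.IsStrongCyclic π) (hF : T.Sound π F)
    {σ : Solution V D A} {x : State V D} {de : PState V D} (hx : T.Deadend F σ x)
    (hde : T.Generalizes x de) : T.Sound π (F ∪ T.fsaps de) := by
  rintro s hs hng a ha ⟨ps, hps | hps, hsat⟩
  · exact hF s hs hng a ha ⟨ps, hps, hsat⟩
  obtain ⟨⟨a', o⟩, ⟨ho, hc⟩, heq⟩ := hps
  obtain ⟨rfl, rfl⟩ := Prod.mk.inj heq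
  have hs' := hs.tail ⟨hng, a, ha, T.sat_pre_of_sat_regr hsat, o, ho, rfl⟩
  have hsde := T.sat_app_of_sat_regr hc hsat
  obtain ⟨-, g, hg, hgoal⟩ := hπ _ hs'
  -- A state covered by `de` is the deadend itself or a deadend of the delete relaxation.
  rcases hde.eq_or_relaxedDeadend with rfl | hr
  · rw [eq_of_sat_toP hsde] at hs' hg
    exact T.not_deadend σ hF hs' hg hgoal hx
  · exact T.not_relaxedDeadend hsde hg hgoal hr

/-! ### The invariant of a partial solution -/

/-- The edges of the controller. -/
def Edge (σ : Solution V D A) (r r' : Ref V D) : Prop :=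
  ∃ n ss o, r = .node n ∧ σ.ctrl n = some ss ∧ ss.out o = some r'

/-- Reachability in the controller. -/
abbrev Reach (σ : Solution V D A) : Ref V D → Ref V D → Prop :=
  Relation.ReflTransGen (Edge σ)

/-- A legitimate target for an edge that leads to the state `s`: a controller node that matches `s`
and that either is the node of `s` itself or belongs to the frozen set `X`. -/
def Target (σ : Solution V D A) (X : Set (Ref V D)) (s : State V D) (r : Ref V D) : Prop :=
  ∃ p, T.cond σ r = some p ∧ Sat s p ∧ (r = .node s ∨ r ∈ X)

/-- The local invariant of a controller. The set `X` consists of nodes that are no longer changed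
(the nodes marked strong cyclic, when a search node is taken up), and `Q` is the set of search nodes
that are not handled yet; it is kept apart from `σ.pending`, since a search node is removed there
before the controller is extended. -/
structure Core (X : Set (Ref V D)) (Q : Set (Entry V D)) (σ : Solution V D A) : Prop where
  goal_mem : .goal ∈ X
  full_of_mem : ∀ n, .node n ∈ X →
    ∃ ss, σ.ctrl n = some ss ∧ ∀ o ∈ T.eff ss.act, ss.out o ≠ none
  mem_of_edge : ∀ n ss o r, .node n ∈ X → σ.ctrl n = some ss → ss.out o = some r → r ∈ X
  /-- Fixed-point regression does not change a node in `X`. -/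
  fix_of_mem : ∀ n ss o r p, .node n ∈ X → σ.ctrl n = some ss → ss.out o = some r →
    T.cond σ r = some p → n ∉ σ.poisoned → ¬ IsPoisoned σ r →
    upd ss.ps (T.regr p ss.act o) = ss.ps
  /-- This keeps the regressed conditions from contradicting each other. -/
  sat_ps : ∀ n ss, σ.ctrl n = some ss → Sat n ss.ps
  pre_le : ∀ n ss, σ.ctrl n = some ss → ∀ x d, T.pre ss.act x = some d → ss.ps x = some d
  exp_mem : ∀ n ss, σ.ctrl n = some ss → ss.exp ∈ T.eff ss.act
  out_mem : ∀ n ss o r, σ.ctrl n = some ss → ss.out o = some r → o ∈ T.eff ss.act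
  /-- The edges of case 0 and those to the goal node lead into `X`, all others to the node of the
  resulting state. -/
  target : ∀ n ss o r, σ.ctrl n = some ss → ss.out o = some r → T.Target σ X (app n o) r
  entry : ∀ m o, some (m, o) ∈ Q → ∃ ss, σ.ctrl m = some ss ∧ o ∈ T.eff ss.act ∧ ss.out o = none
  poisoned_ctrl : ∀ n ∈ σ.poisoned, σ.ctrl n ≠ none
  reach_goal : σ.poisoned = ∅ → ∀ n, σ.ctrl n ≠ none → Reach σ (.node n) .goal
  /-- Without poisoned nodes, no outcome is ever lost. -/
  full : σ.poisoned = ∅ → ∀ n ss o, σ.ctrl n = some ss → o ∈ T.eff ss.act → ss.out o = none →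
    some (n, o) ∈ Q
  /-- Poisoning leaves an outcome that is never going to be handled. -/
  lost : σ.poisoned.Nonempty → ∃ n ss o, σ.ctrl n = some ss ∧ o ∈ T.eff ss.act ∧
    ss.out o = none ∧ some (n, o) ∉ Q

variable {T} {X : Set (Ref V D)} {Q Q' : Set (Entry V D)} {σ σ' : Solution V D A}

theorem Core.sat_pre (h : T.Core X Q σ) {n : State V D} {ss : SolStep V D A}
    (hn : σ.ctrl n = some ss) : Sat n (T.pre ss.act) :=
  sat_iff.2 fun x d hx => sat_iff.1 (h.sat_ps n ss hn) x d (h.pre_le n ss hn x d hx)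

theorem Core.congr (h : T.Core X Q σ) (hc : σ'.ctrl = σ.ctrl) (hp : σ'.poisoned = σ.poisoned) :
    T.Core X Q σ' := by
  obtain ⟨c, r, q, p⟩ := σ
  obtain ⟨c', r', q', p'⟩ := σ'
  cases hc
  cases hp
  exact ⟨h.1, h.2, h.3, h.4, h.5, h.6, h.7, h.8, h.9, h.10, h.11, h.12, h.13, h.14⟩

theorem Core.mono (h : T.Core X Q σ) (hQ : Q' ⊆ Q)
    (hp : σ.poisoned = ∅ → ∀ n o, some (n, o) ∈ Q → some (n, o) ∈ Q') : T.Core X Q' σ :=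
  { h with
    entry := fun m o he => h.entry m o (hQ he)
    full := fun h0 n ss o h1 h2 h3 => hp h0 n o (h.full h0 n ss o h1 h2 h3)
    lost := fun h0 => by
      obtain ⟨n, ss, o, h1, h2, h3, h4⟩ := h.lost h0
      exact ⟨n, ss, o, h1, h2, h3, fun h5 => h4 (hQ h5)⟩ }

/-- Every edge of `σ` is an edge of `σ'`. -/
theorem Edge.mono {σ σ' : Solution V D A}
    (h : ∀ n ss, σ.ctrl n = some ss →
      ∃ ss', σ'.ctrl n = some ss' ∧ ∀ o r, ss.out o = some r → ss'.out o = some r)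
    {r r' : Ref V D} (hr : Reach σ r r') : Reach σ' r r' := by
  refine Relation.ReflTransGen.mono (p := Edge σ') ?_ _ _ hr
  rintro _ _ ⟨n, ss, o, rfl, hn, ho⟩
  obtain ⟨ss', hn', hss⟩ := h n ss hn
  exact ⟨n, ss', o, rfl, hn', hss o _ ho⟩

theorem cond_node_eq {r : Ref V D} {p : PState V D} (h : T.cond σ r = some p) :
    r = .goal ∧ p = T.goal ∨ ∃ n ss, r = .node n ∧ σ.ctrl n = some ss ∧ p = ss.ps := by
  cases r with
  | goal => exact .inl ⟨rfl, (Option.some.inj h).symm⟩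
  | node n =>
    obtain ⟨ss, h1, h2⟩ := Option.map_eq_some_iff.1 h
    exact .inr ⟨n, ss, rfl, h1, h2.symm⟩

theorem cond_congr (T : Task V D A) {r : Ref V D} (h : ∀ n, r = .node n → σ'.ctrl n = σ.ctrl n) :
    T.cond σ' r = T.cond σ r := by
  cases r with
  | goal => rfl
  | node n => simp only [cond, h n rfl]

theorem isPoisoned_congr (h : σ'.poisoned = σ.poisoned) {r : Ref V D} :
    IsPoisoned σ' r ↔ IsPoisoned σ r := by
  cases r <;> simp [IsPoisoned, h]

theorem edge_mono_of_update {m : State V D} {ss₁ : SolStep V D A}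
    (hc : σ'.ctrl = Function.update σ.ctrl m (some ss₁))
    (hext : ∀ ss, σ.ctrl m = some ss → ∀ o r, ss.out o = some r → ss₁.out o = some r)
    (n : State V D) (ss : SolStep V D A) (hn : σ.ctrl n = some ss) :
    ∃ ss', σ'.ctrl n = some ss' ∧ ∀ o r, ss.out o = some r → ss'.out o = some r := by
  by_cases h : n = m
  · subst h
    exact ⟨ss₁, by rw [hc, Function.update_self], hext ss hn⟩
  · exact ⟨ss, by rw [hc, Function.update_of_ne h, hn], fun _ _ => id⟩

theorem Target.update {m : State V D} {ss₁ : SolStep V D A}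
    (hc : σ'.ctrl = Function.update σ.ctrl m (some ss₁)) (hm : .node m ∉ X)
    (hs : Sat m ss₁.ps) {s : State V D} {r : Ref V D} (h : T.Target σ X s r) :
    T.Target σ' X s r := by
  obtain ⟨p, hp, hsp, hr⟩ := h
  by_cases hrm : r = .node m
  · subst hrm
    rcases hr with hr | hr
    · cases hr
      exact ⟨ss₁.ps, by simp [cond, hc], hs, .inl rfl⟩
    · exact absurd hr hm
  · refine ⟨p, ?_, hsp, hr⟩
    rw [← hp]
    refine T.cond_congr fun n hn => ?_
    rw [hc, Function.update_of_ne]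
    rintro rfl
    exact hrm hn

/-- The local invariant is preserved when a single node outside of `X` is created or changed. -/
theorem Core.update (h : T.Core X Q σ) {m : State V D} {ss₁ : SolStep V D A}
    (hc : σ'.ctrl = Function.update σ.ctrl m (some ss₁)) (hp : σ'.poisoned = σ.poisoned)
    (hm : .node m ∉ X) (hs : Sat m ss₁.ps)
    (hpre : ∀ x d, T.pre ss₁.act x = some d → ss₁.ps x = some d)
    (hexp : ss₁.exp ∈ T.eff ss₁.act)
    (hout : ∀ o r, ss₁.out o = some r → o ∈ T.eff ss₁.act ∧ T.Target σ X (app m o) r)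
    (hext : ∀ ss, σ.ctrl m = some ss → ss₁.act = ss.act ∧
      (∀ o r, ss.out o = some r → ss₁.out o = some r) ∧
      ∀ o, ss.out o = none → some (m, o) ∉ Q → ss₁.out o = none ∧ some (m, o) ∉ Q')
    (hQ : ∀ n o, n ≠ m → (some (n, o) ∈ Q' ↔ some (n, o) ∈ Q))
    (hQm : ∀ o, some (m, o) ∈ Q' → o ∈ T.eff ss₁.act ∧ ss₁.out o = none)
    (hnew : σ.poisoned = ∅ → σ.ctrl m = none → ∃ o r, ss₁.out o = some r)
    (hfull : σ.poisoned = ∅ → ∀ o ∈ T.eff ss₁.act, ss₁.out o = none → some (m, o) ∈ Q') :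
    T.Core X Q' σ' := by
  have hm' : σ'.ctrl m = some ss₁ := by rw [hc, Function.update_self]
  have hne : ∀ n, n ≠ m → σ'.ctrl n = σ.ctrl n := fun n hn => by rw [hc, Function.update_of_ne hn]
  have hX : ∀ n, .node n ∈ X → σ'.ctrl n = σ.ctrl n := fun n hn =>
    hne n (by rintro rfl; exact hm hn)
  have hmono := edge_mono_of_update hc fun ss hss => (hext ss hss).2.1
  refine ⟨h.goal_mem, ?_, ?_, ?_, ?_, ?_, ?_, ?_, ?_, ?_, ?_, ?_, ?_, ?_⟩
  · intro n hn
    rw [hX n hn]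
    exact h.full_of_mem n hn
  · intro n ss o r hn hss
    rw [hX n hn] at hss
    exact h.mem_of_edge n ss o r hn hss
  · intro n ss o r p hn hss ho hr hpn hpr
    rw [hX n hn] at hss
    rw [hp] at hpn
    rw [isPoisoned_congr hp] at hpr
    have hrX := h.mem_of_edge n ss o r hn hss ho
    rw [T.cond_congr fun k hk => hX k (hk ▸ hrX)] at hr
    exact h.fix_of_mem n ss o r p hn hss ho hr hpn hpr
  · intro n ss hn
    by_cases hnm : n = m
    · subst hnm
      cases hm'.symm.trans hn
      exact hs
    · exact h.sat_ps n ss (hne n hnm ▸ hn)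
  · intro n ss hn
    by_cases hnm : n = m
    · subst hnm
      cases hm'.symm.trans hn
      exact hpre
    · exact h.pre_le n ss (hne n hnm ▸ hn)
  · intro n ss hn
    by_cases hnm : n = m
    · subst hnm
      cases hm'.symm.trans hn
      exact hexp
    · exact h.exp_mem n ss (hne n hnm ▸ hn)
  · intro n ss o r hn ho
    by_cases hnm : n = m
    · subst hnm
      cases hm'.symm.trans hn
      exact (hout o r ho).1
    · exact h.out_mem n ss o r (hne n hnm ▸ hn) ho
  · intro n ss o r hn ho
    refine Target.update hc hm hs ?_
    by_cases hnm : n = m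
    · subst hnm
      cases hm'.symm.trans hn
      exact (hout o r ho).2
    · exact h.target n ss o r (hne n hnm ▸ hn) ho
  · intro n o ho
    by_cases hnm : n = m
    · subst hnm
      exact ⟨ss₁, hm', hQm o ho⟩
    · rw [hne n hnm]
      exact h.entry n o ((hQ n o hnm).1 ho)
  · intro n hn
    by_cases hnm : n = m
    · subst hnm
      simp [hm']
    · rw [hne n hnm]
      exact h.poisoned_ctrl n (hp ▸ hn)
  · intro h0 n hn
    rw [hp] at h0
    have hold : ∀ k, σ.ctrl k ≠ none → Reach σ' (.node k) .goal := fun k hk =>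
      Edge.mono hmono (h.reach_goal h0 k hk)
    by_cases hk : σ.ctrl n = none
    · have hnm : n = m := by
        by_contra hnm
        exact hn (hne n hnm ▸ hk)
      subst hnm
      obtain ⟨o, r, hor⟩ := hnew h0 hk
      obtain ⟨-, p, hr, -, -⟩ := hout o r hor
      refine .head ⟨n, ss₁, o, rfl, hm', hor⟩ ?_
      rcases cond_node_eq hr with ⟨rfl, -⟩ | ⟨k, ss, rfl, hk, -⟩
      · exact .refl
      · exact hold k (by simp [hk])
    · exact hold n hk
  · intro h0 n ss o hn ho hno
    rw [hp] at h0
    by_cases hnm : n = m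
    · subst hnm
      cases hm'.symm.trans hn
      exact hfull h0 o ho hno
    · exact (hQ n o hnm).2 (h.full h0 n ss o (hne n hnm ▸ hn) ho hno)
  · intro h0
    rw [hp] at h0
    obtain ⟨n, ss, o, h1, h2, h3, h4⟩ := h.lost h0
    by_cases hnm : n = m
    · subst hnm
      obtain ⟨hact, -, hn⟩ := hext ss h1
      exact ⟨n, ss₁, o, hm', hact ▸ h2, hn o h3 h4⟩
    · exact ⟨n, ss, o, (hne n hnm).trans h1, h2, h3, fun h5 => h4 ((hQ n o hnm).1 h5)⟩

/-! ### Adding a weak plan -/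

theorem link_of_poisoned {m : State V D} {o : PState V D} {r : Ref V D}
    (h : m ∈ σ.poisoned ∨ IsPoisoned σ r) : link σ m o r = σ := if_pos h

theorem link_of_not_poisoned {m : State V D} {o : PState V D} {r : Ref V D}
    (h : ¬ (m ∈ σ.poisoned ∨ IsPoisoned σ r)) : link σ m o r =
      { σ with
        ctrl := Function.update σ.ctrl m
          ((σ.ctrl m).map fun ss => { ss with out := Function.update ss.out o (some r) }) } :=
  if_neg h

@[simp] theorem link_root (σ : Solution V D A) (m : State V D) (o : PState V D) (r : Ref V D) :
    (link σ m o r).root = σ.root := by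
  unfold link; split_ifs <;> rfl

@[simp] theorem link_pending (σ : Solution V D A) (m : State V D) (o : PState V D)
    (r : Ref V D) : (link σ m o r).pending = σ.pending := by
  unfold link; split_ifs <;> rfl

@[simp] theorem link_poisoned (σ : Solution V D A) (m : State V D) (o : PState V D)
    (r : Ref V D) : (link σ m o r).poisoned = σ.poisoned := by
  unfold link; split_ifs <;> rfl

theorem exists_link_ctrl_iff (σ : Solution V D A) (m n : State V D) (o : PState V D)
    (r : Ref V D) (a : A) :
    (∃ ss, (link σ m o r).ctrl n = some ss ∧ ss.act = a) ↔
      ∃ ss, σ.ctrl n = some ss ∧ ss.act = a := by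
  unfold link; split_ifs
  · rfl
  · by_cases h : n = m
    · subst h
      simp only [Function.update_self, Option.map_eq_some_iff]
      aesop
    · simp only [Function.update_of_ne h]

/-- The search nodes that a step of a weak plan leaves to be handled. -/
def stepEntries (T : Task V D A) (st : PlanStep V D A) : Set (Entry V D) :=
  {e | ∃ o ∈ T.eff st.act, o ≠ st.outc ∧ e = some (st.state, o)}

/-- The search nodes that a weak plan leaves to be handled. -/
def planEntries (T : Task V D A) (l : List (PlanStep V D A)) : Set (Entry V D) :=
  {e | ∃ st ∈ l, e ∈ T.stepEntries st}

theorem planEntries_cons (st : PlanStep V D A) (l : List (PlanStep V D A)) :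
    T.planEntries (st :: l) = T.planEntries l ∪ T.stepEntries st := by
  ext e
  simp only [planEntries, List.mem_cons, exists_eq_or_imp]
  exact or_comm

/-- The solution extended by a step of a weak plan that is continued at `r`. -/
noncomputable def addNode (T : Task V D A) (σ : Solution V D A) (st : PlanStep V D A)
    (r : Ref V D) : Solution V D A :=
  link
    { σ with
      ctrl := Function.update σ.ctrl st.state
        (some ⟨T.pre st.act, st.act, st.outc, fun _ => none, st.orig⟩)
      pending := σ.pending ∪ T.stepEntries st }
    st.state st.outc r

theorem addPlan_cons (st : PlanStep V D A) (l : List (PlanStep V D A)) (r : Ref V D) :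
    T.addPlan σ (st :: l) r = T.addNode (T.addPlan σ l r) st (firstRef l r) := rfl

/-- The node that `addNode` creates. -/
noncomputable def newNode (T : Task V D A) (σ : Solution V D A) (st : PlanStep V D A)
    (r : Ref V D) : SolStep V D A :=
  ⟨T.pre st.act, st.act, st.outc,
    if st.state ∈ σ.poisoned ∨ IsPoisoned σ r then fun _ => none
    else Function.update (fun _ => none) st.outc (some r), st.orig⟩

theorem addNode_ctrl (st : PlanStep V D A) (r : Ref V D) :
    (T.addNode σ st r).ctrl = Function.update σ.ctrl st.state (some (T.newNode σ st r)) := by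
  unfold addNode newNode
  by_cases h : st.state ∈ σ.poisoned ∨ IsPoisoned σ r
  · rw [link_of_poisoned (by cases r <;> simpa [IsPoisoned] using h), if_pos h]
  · rw [link_of_not_poisoned (by cases r <;> simpa [IsPoisoned] using h), if_neg h]
    simp

theorem Core.addNode (h : T.Core X Q σ) {st : PlanStep V D A} {r : Ref V D}
    (hst : σ.ctrl st.state = none) (hpre : Sat st.state (T.pre st.act))
    (ho : st.outc ∈ T.eff st.act) (hr : T.Target σ X (app st.state st.outc) r) :
    T.Core X (Q ∪ T.stepEntries st) (T.addNode σ st r) := by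
  have hnp : st.state ∉ σ.poisoned := fun hp => h.poisoned_ctrl _ hp hst
  have hout : ∀ o r', (T.newNode σ st r).out o = some r' → o = st.outc ∧ r' = r := by
    intro o r' hor
    unfold newNode at hor
    split_ifs at hor
    by_cases hoo : o = st.outc
    · subst hoo
      simp only [Function.update_self, Option.some.injEq] at hor
      exact ⟨rfl, hor.symm⟩
    · simp [Function.update_of_ne hoo] at hor
  have hlink : ¬ IsPoisoned σ r → (T.newNode σ st r).out st.outc = some r := by
    intro hp
    simp [newNode, hp, hnp]
  have hnop : σ.poisoned = ∅ → ¬ IsPoisoned σ r := by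
    intro h0
    cases r <;> simp [IsPoisoned, h0]
  refine h.update (T.addNode_ctrl st r) (by simp [Task.addNode]) ?_ hpre (fun x d hx => hx) ho
    ?_ ?_ ?_ ?_ ?_ ?_
  · intro hX
    obtain ⟨ss, hss, -⟩ := h.full_of_mem _ hX
    simp [hst] at hss
  · intro o r' hor
    obtain ⟨rfl, rfl⟩ := hout o r' hor
    exact ⟨ho, hr⟩
  · simp [hst]
  · intro n o hn
    have : (some (n, o) : Entry V D) ∉ T.stepEntries st := by
      rintro ⟨o', -, -, heq⟩
      cases heq
      exact hn rfl
    simp [this]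
  · rintro o (hQ | ⟨o', ho', hne, heq⟩)
    · obtain ⟨ss, hss, -⟩ := h.entry _ _ hQ
      simp [hst] at hss
    · cases heq
      refine ⟨ho', ?_⟩
      cases hor : (T.newNode σ st r).out o with
      | none => rfl
      | some r' => exact absurd (hout o r' hor).1 hne
  · intro h0 _
    exact ⟨_, r, hlink (hnop h0)⟩
  · intro h0 o ho' hno
    refine .inr ⟨o, ho', ?_, rfl⟩
    rintro rfl
    rw [hlink (hnop h0)] at hno
    cases hno

/-- A weak plan from the state `s` that can be added to the solution: it goes through states that
are not expanded, by executable actions that are not forbidden, and is continued at a legitimate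
target. -/
def Chain (T : Task V D A) (F : Set (PState V D × A)) (X : Set (Ref V D)) (σ : Solution V D A) :
    State V D → List (PlanStep V D A) → Ref V D → Prop
  | s, [], t => T.Target σ X s t
  | s, st :: l, t => st.state = s ∧ σ.ctrl s = none ∧ Sat s (T.pre st.act) ∧
      ¬ Forbidden F s st.act ∧ st.outc ∈ T.eff st.act ∧ Chain T F X σ (app s st.outc) l t

theorem addPlan_root (l : List (PlanStep V D A)) (t : Ref V D) :
    (T.addPlan σ l t).root = σ.root := by
  induction l with
  | nil => rfl
  | cons st l ih => simpa [addPlan_cons, addNode] using ih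

theorem addPlan_poisoned (l : List (PlanStep V D A)) (t : Ref V D) :
    (T.addPlan σ l t).poisoned = σ.poisoned := by
  induction l with
  | nil => rfl
  | cons st l ih => simpa [addPlan_cons, addNode] using ih

theorem addPlan_pending (l : List (PlanStep V D A)) (t : Ref V D) :
    (T.addPlan σ l t).pending = σ.pending ∪ T.planEntries l := by
  induction l with
  | nil => simp [addPlan, planEntries]
  | cons st l ih =>
    rw [addPlan_cons]
    simp only [addNode, link_pending, ih, planEntries_cons, Set.union_assoc]

theorem addPlan_ctrl_of_notMem {l : List (PlanStep V D A)} (t : Ref V D) {n : State V D}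
    (h : n ∉ l.map PlanStep.state) : (T.addPlan σ l t).ctrl n = σ.ctrl n := by
  induction l with
  | nil => rfl
  | cons st l ih =>
    rw [List.map_cons, List.mem_cons, not_or] at h
    rw [addPlan_cons, addNode_ctrl, Function.update_of_ne h.1, ih h.2]

theorem addPlan_ctrl_of_mem {F : Set (PState V D × A)} {l : List (PlanStep V D A)} {t : Ref V D}
    {s n : State V D} (hl : T.Chain F X σ s l t) (h : n ∈ l.map PlanStep.state) :
    σ.ctrl n = none ∧ ∃ ss, (T.addPlan σ l t).ctrl n = some ss ∧ ¬ Forbidden F n ss.act := by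
  induction l generalizing s with
  | nil => simp at h
  | cons st l ih =>
    obtain ⟨rfl, hst, -, hforb, -, hl⟩ := hl
    rw [addPlan_cons, addNode_ctrl]
    by_cases hn : n = st.state
    · subst hn
      exact ⟨hst, _, Function.update_self .., hforb⟩
    · rw [Function.update_of_ne hn]
      rw [List.map_cons, List.mem_cons] at h
      exact ih hl (h.resolve_left hn)

/-- A weak plan is added from its end, so that the target of each new edge exists already. -/
theorem addPlan_spec {F : Set (PState V D × A)} {l : List (PlanStep V D A)} {t : Ref V D}
    {s : State V D} (h : T.Core X Q σ) (hl : T.Chain F X σ s l t)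
    (hnd : (l.map PlanStep.state).Nodup) :
    T.Core X (Q ∪ T.planEntries l) (T.addPlan σ l t) ∧
      T.Target (T.addPlan σ l t) X s (firstRef l t) ∧
      ∀ n ∈ l.map PlanStep.state, Reach (T.addPlan σ l t) (firstRef l t) (.node n) := by
  induction l generalizing s with
  | nil => exact ⟨by simpa [addPlan, planEntries] using h, hl, by simp⟩
  | cons st l ih =>
    obtain ⟨rfl, hst, hpre, -, ho, hl⟩ := hl
    rw [List.map_cons, List.nodup_cons] at hnd
    obtain ⟨hcore, htgt, hreach⟩ := ih hl hnd.2
    have hst' : (T.addPlan σ l t).ctrl st.state = none := by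
      rw [addPlan_ctrl_of_notMem t hnd.1, hst]
    have hctrl := T.addNode_ctrl (σ := T.addPlan σ l t) st (firstRef l t)
    refine ⟨?_, ?_, ?_⟩
    · have := hcore.addNode hst' hpre ho htgt
      rwa [addPlan_cons, planEntries_cons, ← Set.union_assoc]
    · refine ⟨T.pre st.act, ?_, hpre, .inl rfl⟩
      change ((T.addNode _ st (firstRef l t)).ctrl st.state).map SolStep.ps = _
      simp [hctrl, newNode]
    · intro n hn
      rw [List.map_cons, List.mem_cons] at hn
      rcases hn with rfl | hn
      · exact .refl
      rw [addPlan_cons]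
      -- The remaining plan is not empty, so that its first node is new and hence not poisoned.
      have hfirst : ¬ IsPoisoned (T.addPlan σ l t) (firstRef l t) := by
        cases l with
        | nil => simp at hn
        | cons st' l =>
          obtain ⟨heq, hst₂, -⟩ := hl
          rw [← heq] at hst₂
          simp only [firstRef, IsPoisoned, addPlan_poisoned]
          exact fun hp => h.poisoned_ctrl _ hp hst₂
      have hnp : st.state ∉ (T.addPlan σ l t).poisoned := fun hp =>
        hcore.poisoned_ctrl _ hp hst'
      refine .head ⟨st.state, T.newNode (T.addPlan σ l t) st (firstRef l t), st.outc, rfl, ?_, ?_⟩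
        (Edge.mono (edge_mono_of_update hctrl ?_) (hreach n hn))
      · rw [hctrl, Function.update_self]
      · simp [newNode, hfirst, hnp]
      · simp [hst']

theorem Core.link (h : T.Core X Q σ) {m : State V D} {o : PState V D} {r : Ref V D}
    (he : some (m, o) ∈ Q) (hr : T.Target σ X (app m o) r) :
    T.Core X (Q \ {some (m, o)}) (link σ m o r) := by
  by_cases hp : m ∈ σ.poisoned ∨ IsPoisoned σ r
  · rw [link_of_poisoned hp]
    refine h.mono Set.sdiff_subset fun h0 => ?_
    cases r <;> simp [h0, IsPoisoned] at hp
  obtain ⟨ss, hss, ho, hno⟩ := h.entry m o he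
  have hctrl : (Task.link σ m o r).ctrl =
      Function.update σ.ctrl m (some { ss with out := Function.update ss.out o (some r) }) := by
    rw [link_of_not_poisoned hp, hss]
    rfl
  refine h.update hctrl (link_poisoned ..) ?_ (h.sat_ps m ss hss) (h.pre_le m ss hss)
    (h.exp_mem m ss hss) ?_ ?_ ?_ ?_ ?_ ?_
  -- A node with an outcome that is still to be handled is not frozen.
  · intro hX
    obtain ⟨ss', hss', hf⟩ := h.full_of_mem _ hX
    cases hss.symm.trans hss'
    exact hf o ho hno
  · intro o' r' hor
    by_cases hoo : o' = o
    · subst hoo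
      simp only [Function.update_self, Option.some.injEq] at hor
      subst hor
      exact ⟨ho, hr⟩
    · simp only [Function.update_of_ne hoo] at hor
      exact ⟨h.out_mem m ss o' r' hss hor, h.target m ss o' r' hss hor⟩
  · intro ss' hss'
    cases hss.symm.trans hss'
    refine ⟨rfl, fun o' r' hor => ?_, fun o' ho' hQ => ⟨?_, fun h' => hQ h'.1⟩⟩
    · have : o' ≠ o := by
        rintro rfl
        simp [hno] at hor
      simpa [Function.update_of_ne this] using hor
    · have : o' ≠ o := by
        rintro rfl
        exact hQ he
      simpa [Function.update_of_ne this] using ho'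
  · intro n o' hn
    simp [hn]
  · rintro o' ⟨hQ, hne⟩
    obtain ⟨ss', hss', h1, h2⟩ := h.entry m o' hQ
    cases hss.symm.trans hss'
    have : o' ≠ o := by
      rintro rfl
      exact hne rfl
    exact ⟨h1, by simpa [Function.update_of_ne this] using h2⟩
  · simp [hss]
  · intro h0 o' ho' hno'
    have hoo : o' ≠ o := by
      rintro rfl
      simp at hno'
    refine ⟨h.full h0 m ss o' hss ho' (by simpa [Function.update_of_ne hoo] using hno'), ?_⟩
    simp [hoo]

/-! ### Fixed-point regression -/

theorem exists_undefined_of_upd_ne {s : State V D} {p q : PState V D} (hp : Sat s p) (hq : Sat s q)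
    (h : upd p q ≠ p) : ∃ x, p x = none ∧ upd p q x ≠ none := by
  rw [sat_iff] at *
  obtain ⟨x, hx⟩ := Function.ne_iff.1 h
  refine ⟨x, ?_⟩
  unfold upd at hx ⊢
  split_ifs at hx ⊢ with h1
  · obtain ⟨d, hd⟩ := Option.ne_none_iff_exists'.1 h1
    refine ⟨?_, h1⟩
    by_contra hpx
    obtain ⟨d', hd'⟩ := Option.ne_none_iff_exists'.1 hpx
    exact hx (by rw [hd, hd', ← hp x d' hd', hq x d hd])
  · exact absurd rfl hx

/-- The variables defined in the conditions of the controller nodes. -/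
def definedVars (σ : Solution V D A) : Set (State V D × V) :=
  {nx | ∃ ss, σ.ctrl nx.1 = some ss ∧ ss.ps nx.2 ≠ none}

/-- The conditions of the controller grow within the states that the nodes were created for. -/
theorem FprStep.spec (h : T.Core X Q σ) (hstep : T.FprStep σ σ') :
    T.Core X Q σ' ∧ definedVars σ ⊂ definedVars σ' ∧ σ'.root = σ.root ∧
      σ'.pending = σ.pending ∧ σ'.poisoned = σ.poisoned ∧
      (∀ n, (σ'.ctrl n).map (fun ss => (ss.act, ss.out)) =
        (σ.ctrl n).map (fun ss => (ss.act, ss.out))) := by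
  obtain ⟨n, ss, o, r, p, hss, ho, hr, hn, hpr, hne, rfl⟩ := hstep
  -- The edge leads to a node that matches, so that the regressed condition holds in `n` as well.
  have hsat : Sat n (T.regr p ss.act o) := by
    obtain ⟨p', hr', hsp, -⟩ := h.target n ss o r hss ho
    cases hr.symm.trans hr'
    exact T.sat_regr (h.sat_pre hss) hsp
  refine ⟨?_, ?_, rfl, rfl, rfl, ?_⟩
  · refine h.update rfl rfl ?_ ((h.sat_ps n ss hss).upd hsat) ?_ (h.exp_mem n ss hss) ?_ ?_ ?_ ?_
      ?_ ?_
    · exact fun hX => hne (h.fix_of_mem n ss o r p hX hss ho hr hn hpr)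
    · intro x d hx
      simp only at hx ⊢
      simp [upd, regr, hx]
    · exact fun o' r' hor => ⟨h.out_mem n ss o' r' hss hor, h.target n ss o' r' hss hor⟩
    · intro ss' hss'
      cases hss.symm.trans hss'
      exact ⟨rfl, fun _ _ => id, fun _ => .intro⟩
    · exact fun _ _ _ => Iff.rfl
    · intro o' hQ
      obtain ⟨ss', hss', h1⟩ := h.entry n o' hQ
      cases hss.symm.trans hss'
      exact h1
    · simp [hss]
    · exact fun h0 o' ho' hno => h.full h0 n ss o' hss ho' hno
  · rw [Set.ssubset_iff_of_subset]
    · obtain ⟨x, hx, hx'⟩ := exists_undefined_of_upd_ne (h.sat_ps n ss hss) hsat hne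
      exact ⟨(n, x), ⟨_, Function.update_self (f := σ.ctrl) .., hx'⟩,
        by simp [definedVars, hss, hx]⟩
    · rintro ⟨k, x⟩ ⟨ss', hk, hx⟩
      by_cases hkn : k = n
      · subst hkn
        cases hss.symm.trans hk
        refine ⟨_, Function.update_self (f := σ.ctrl) .., ?_⟩
        simp only [upd]
        split_ifs with h1
        · exact h1
        · exact hx
      · exact ⟨ss', by simp [Function.update_of_ne hkn, hk], hx⟩
  · intro k
    by_cases hkn : k = n
    · subst hkn
      simp [hss]
    · simp [Function.update_of_ne hkn]

theorem FprSteps.spec (h : T.Core X Q σ) (hsteps : Relation.ReflTransGen T.FprStep σ σ') :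
    T.Core X Q σ' ∧ σ'.root = σ.root ∧ σ'.pending = σ.pending ∧ σ'.poisoned = σ.poisoned ∧
      (∀ n, (σ'.ctrl n).map (fun ss => (ss.act, ss.out)) =
        (σ.ctrl n).map (fun ss => (ss.act, ss.out))) := by
  induction hsteps with
  | refl => exact ⟨h, rfl, rfl, rfl, fun _ => rfl⟩
  | tail _ hstep ih =>
    obtain ⟨h1, h2, h3, h4, h5⟩ := ih
    obtain ⟨g1, -, g2, g3, g4, g5⟩ := FprStep.spec h1 hstep
    exact ⟨g1, g2.trans h2, g3.trans h3, g4.trans h4, fun n => (g5 n).trans (h5 n)⟩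

end Task

/-- A relation whose steps strictly enlarge some subset of a finite type leads to a normal form. -/
theorem exists_normal_form {α β : Type*} [Finite β] {r : α → α → Prop} {P : α → Prop}
    (f : α → Set β) (h : ∀ a b, P a → r a b → P b ∧ f a ⊂ f b) (a : α) (ha : P a) :
    ∃ b, Relation.ReflTransGen r a b ∧ ∀ c, ¬ r b c := by
  have key : ∀ s : Set β, ∀ a, P a → f a = s → ∃ b, Relation.ReflTransGen r a b ∧ ∀ c, ¬ r b c := by
    intro s
    induction s using (wellFounded_gt (α := Set β)).induction with
    | _ s ih =>
      rintro a ha rfl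
      by_cases hc : ∃ c, r a c
      · obtain ⟨c, hc⟩ := hc
        obtain ⟨hPc, hlt⟩ := h a c ha hc
        obtain ⟨b, hb, hb'⟩ := ih _ hlt c hPc rfl
        exact ⟨b, .head hc hb, hb'⟩
      · exact ⟨a, .refl, fun c h => hc ⟨c, h⟩⟩
  exact key _ a ha rfl

namespace Task

variable {T : Task V D A} {X : Set (Ref V D)} {Q : Set (Entry V D)} {σ σ' : Solution V D A}
  {F F' : Set (PState V D × A)} {e : Entry V D}

theorem exists_fpr [Finite V] [∀ x, Finite (D x)] (h : T.Core X Q σ) : ∃ σ', T.Fpr σ σ' :=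
  exists_normal_form definedVars
    (fun _ _ ha hr => ⟨(FprStep.spec ha hr).1, (FprStep.spec ha hr).2.1⟩) σ h

theorem exists_generalizes [Finite V] (T : Task V D A) (s : State V D) :
    ∃ de, T.Generalizes s de := by
  refine exists_normal_form (P := fun _ => True) (fun p : PState V D => {x | p x = none}) ?_ _
    trivial
  rintro p _ - ⟨x, hx, rfl, -⟩
  refine ⟨trivial, (Set.ssubset_iff_of_subset fun y hy => ?_).2 ⟨x, by simp, hx⟩⟩
  by_cases hyx : y = x
  · subst hyx
    simp
  · simpa [Function.update_of_ne hyx] using hy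

/-! ### The invariant of the inner loop -/

/-- The nodes that are marked strong cyclic. -/
def marked (T : Task V D A) (σ : Solution V D A) : Set (Ref V D) :=
  {r | T.StrongCyclicMark σ r}

theorem Core.notMem_of_notSC (h : T.Core X Q σ) {r : Ref V D} (hr : T.NotSC σ r) : r ∉ X := by
  induction hr with
  | unhandled n ss o hn ho hno =>
    intro hX
    obtain ⟨ss', hn', hf⟩ := h.full_of_mem n hX
    cases hn.symm.trans hn'
    exact hf o ho hno
  | pred n ss o r hn hor _ ih => exact fun hX => ih (h.mem_of_edge n ss o r hX hn hor)

theorem Core.subset_marked (h : T.Core X Q σ) : X ⊆ T.marked σ := by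
  intro r hr
  refine ⟨?_, fun hn => h.notMem_of_notSC hn hr⟩
  cases r with
  | goal => rfl
  | node n =>
    obtain ⟨ss, hn, -⟩ := h.full_of_mem n hr
    simp [cond, hn]

/-- Once fixed-point regression is completed, all nodes marked strong cyclic can be frozen. -/
theorem Core.to_marked (h : T.Core X Q σ) (hfix : ∀ τ, ¬ T.FprStep σ τ) :
    T.Core (T.marked σ) Q σ :=
  { h with
    goal_mem := h.subset_marked h.goal_mem
    full_of_mem := by
      rintro n ⟨hn, hsc⟩
      obtain ⟨p, hp⟩ := Option.isSome_iff_exists.1 hn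
      obtain ⟨ss, hss, -⟩ := Option.map_eq_some_iff.1 hp
      exact ⟨ss, hss, fun o ho hno => hsc (.unhandled n ss o hss ho hno)⟩
    mem_of_edge := by
      rintro n ss o r ⟨-, hsc⟩ hss hor
      obtain ⟨p, hp, -⟩ := h.target n ss o r hss hor
      exact ⟨by simp [hp], fun hr => hsc (.pred n ss o r hss hor hr)⟩
    fix_of_mem := by
      intro n ss o r p _ hss hor hp hn hr
      by_contra hne
      exact hfix _ ⟨n, ss, o, r, p, hss, hor, hp, hn, hr, hne, rfl⟩
    target := by
      intro n ss o r hss hor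
      obtain ⟨p, hp, hs, hr⟩ := h.target n ss o r hss hor
      exact ⟨p, hp, hs, hr.imp_right fun hX => h.subset_marked hX⟩ }

/-- The part of the invariant about the node of the initial state: it is created first, and all
nodes are reachable from it. -/
structure RootInv (T : Task V D A) (σ : Solution V D A) : Prop where
  empty : none ∈ σ.pending → ∀ n, σ.ctrl n = none
  root : none ∉ σ.pending → ∃ r, σ.root = some r ∧
    (r = .goal ∧ Sat T.init T.goal ∨ r = .node T.init ∧ σ.ctrl T.init ≠ none) ∧
    ∀ n, σ.ctrl n ≠ none → Reach σ r (.node n)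

/-- The invariant of the inner loop. -/
structure Inv (T : Task V D A) (σ : Solution V D A) : Prop where
  core : T.Core (T.marked σ) σ.pending σ
  fixed : ∀ τ, ¬ T.FprStep σ τ
  rootInv : T.RootInv σ

theorem inv_emptySol (T : Task V D A) : T.Inv (emptySol {none}) := by
  have hc : T.Core {.goal} ({none} : Set (Entry V D)) (emptySol {none}) := by
    constructor <;> simp [emptySol]
  have hf : ∀ τ, ¬ T.FprStep (emptySol {none}) τ := by
    rintro τ ⟨n, ss, o, r, p, hss, -⟩
    cases hss
  exact ⟨hc.to_marked hf, hf, ⟨fun _ _ => rfl, fun h => absurd rfl h⟩⟩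

theorem Chain.congr (hc : σ'.ctrl = σ.ctrl) {s : State V D} {l : List (PlanStep V D A)}
    {t : Ref V D} (h : T.Chain F X σ s l t) : T.Chain F X σ' s l t := by
  induction l generalizing s with
  | nil =>
    obtain ⟨p, hp, h⟩ := h
    exact ⟨p, by rw [cond_congr (σ := σ) T fun n _ => by rw [hc], hp], h⟩
  | cons st l ih =>
    obtain ⟨h1, h2, h3, h4, h5, h6⟩ := h
    exact ⟨h1, by rw [hc, h2], h3, h4, h5, ih h6⟩

theorem Chain.pop {s : State V D} {l : List (PlanStep V D A)} {t : Ref V D}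
    (h : T.Chain F X σ s l t) (e : Entry V D) : T.Chain F X (pop σ e) s l t :=
  Chain.congr (σ := σ) (σ' := Task.pop σ e) rfl h

theorem link_ext {m : State V D} {o : PState V D} (r : Ref V D)
    (hno : ∀ ss, σ.ctrl m = some ss → ss.out o = none) (n : State V D) (ss : SolStep V D A)
    (hn : σ.ctrl n = some ss) : ∃ ss', (link σ m o r).ctrl n = some ss' ∧
      ∀ o' r', ss.out o' = some r' → ss'.out o' = some r' := by
  unfold link
  split_ifs
  · exact ⟨ss, hn, fun _ _ => id⟩
  · by_cases hnm : n = m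
    · subst hnm
      refine ⟨{ ss with out := Function.update ss.out o (some r) }, by simp [hn], fun o' r' h => ?_⟩
      have : o' ≠ o := by
        rintro rfl
        simp [hno ss hn] at h
      simpa [Function.update_of_ne this] using h
    · exact ⟨ss, by simp [Function.update_of_ne hnm, hn], fun _ _ => id⟩

theorem link_ctrl_eq_none_iff {m n : State V D} {o : PState V D} {r : Ref V D} :
    (link σ m o r).ctrl n = none ↔ σ.ctrl n = none := by
  unfold link
  split_ifs
  · rfl
  · by_cases hnm : n = m
    · subst hnm
      simp
    · simp [Function.update_of_ne hnm]

theorem attach_ctrl_eq_none_iff {n : State V D} {r : Ref V D} :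
    (attach σ e r).ctrl n = none ↔ σ.ctrl n = none := by
  cases e with
  | none => rfl
  | some mo => exact link_ctrl_eq_none_iff

theorem attach_act {n : State V D} {r : Ref V D} {ss : SolStep V D A}
    (h : (attach σ e r).ctrl n = some ss) : ∃ ss', σ.ctrl n = some ss' ∧ ss'.act = ss.act := by
  cases e with
  | none => exact ⟨ss, h, rfl⟩
  | some mo => exact (exists_link_ctrl_iff σ mo.1 n mo.2 r ss.act).1 ⟨ss, h, rfl⟩

theorem attach_pending {r : Ref V D} : (attach σ e r).pending = σ.pending := by
  cases e with
  | none => rfl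
  | some mo => exact link_pending ..

theorem attach_poisoned {r : Ref V D} : (attach σ e r).poisoned = σ.poisoned := by
  cases e with
  | none => rfl
  | some mo => exact link_poisoned ..

theorem hookPlan_pending (l : List (PlanStep V D A)) (t : Ref V D) :
    (T.hookPlan σ e l t).pending = σ.pending \ {e} ∪ T.planEntries l := by
  rw [hookPlan, attach_pending, addPlan_pending]
  rfl

theorem hookPlan_poisoned (l : List (PlanStep V D A)) (t : Ref V D) :
    (T.hookPlan σ e l t).poisoned = σ.poisoned := by
  rw [hookPlan, attach_poisoned, addPlan_poisoned]
  rfl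

theorem hookPlan_ctrl_eq_none_iff {s : State V D} {l : List (PlanStep V D A)} {t : Ref V D}
    (hl : T.Chain F X σ s l t) (n : State V D) :
    (T.hookPlan σ e l t).ctrl n = none ↔ σ.ctrl n = none ∧ n ∉ l.map PlanStep.state := by
  have hl' : T.Chain F X (pop σ e) s l t := hl.pop e
  rw [hookPlan, attach_ctrl_eq_none_iff]
  by_cases hn : n ∈ l.map PlanStep.state
  · obtain ⟨-, ss, hss, -⟩ := addPlan_ctrl_of_mem hl' hn
    simp [hss, hn]
  · rw [addPlan_ctrl_of_notMem t hn]
    simp [pop, hn]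

theorem hookPlan_not_forbidden {s : State V D} {l : List (PlanStep V D A)} {t : Ref V D}
    (hl : T.Chain F X σ s l t) (hσ : ∀ n ss, σ.ctrl n = some ss → ¬ Forbidden F n ss.act)
    (n : State V D) (ss : SolStep V D A) (h : (T.hookPlan σ e l t).ctrl n = some ss) :
    ¬ Forbidden F n ss.act := by
  have hl' : T.Chain F X (pop σ e) s l t := hl.pop e
  obtain ⟨ss', hss', hact⟩ := attach_act h
  rw [← hact]
  by_cases hn : n ∈ l.map PlanStep.state
  · obtain ⟨-, ss₂, hss₂, hf⟩ := addPlan_ctrl_of_mem hl' hn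
    cases hss'.symm.trans hss₂
    exact hf
  · rw [addPlan_ctrl_of_notMem t hn] at hss'
    exact hσ n ss' hss'

theorem notMem_planEntries {s : State V D} {l : List (PlanStep V D A)} {t : Ref V D}
    (h : T.Core X Q σ) (hl : T.Chain F X σ s l t) (he : e ∈ Q) : e ∉ T.planEntries l := by
  rintro ⟨st, hst, o, -, -, rfl⟩
  obtain ⟨ss, hss, -⟩ := h.entry _ _ he
  obtain ⟨hn, -⟩ := addPlan_ctrl_of_mem hl (List.mem_map_of_mem hst)
  simp [hss] at hn

theorem Core.hookPlan (h : T.Core X σ.pending σ) (he : e ∈ σ.pending)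
    {l : List (PlanStep V D A)} {t : Ref V D} (hl : T.Chain F X σ (T.entryState e) l t)
    (hnd : (l.map PlanStep.state).Nodup) :
    T.Core X (T.hookPlan σ e l t).pending (T.hookPlan σ e l t) := by
  have hpop : T.Core X σ.pending (pop σ e) := h.congr rfl rfl
  have hl' : T.Chain F X (pop σ e) (T.entryState e) l t := hl.pop e
  obtain ⟨hcore, htgt, -⟩ := addPlan_spec hpop hl' hnd
  have hQ : (T.hookPlan σ e l t).pending = (σ.pending ∪ T.planEntries l) \ {e} := by
    have hne := notMem_planEntries h hl he
    rw [hookPlan_pending]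
    ext e'
    by_cases heq : e' = e
    · subst heq
      simp [hne]
    · simp [heq]
  rw [hQ]
  cases e with
  | none =>
    refine (hcore.mono Set.sdiff_subset fun _ n o ho => ⟨ho, by simp⟩).congr rfl rfl
  | some mo => exact hcore.link (.inl he) htgt

theorem RootInv.hookPlan (h : T.Core X σ.pending σ) (hroot : T.RootInv σ) (he : e ∈ σ.pending)
    {l : List (PlanStep V D A)} {t : Ref V D} (hl : T.Chain F X σ (T.entryState e) l t)
    (hnd : (l.map PlanStep.state).Nodup) (hc : l ≠ [] → ¬ Case1 σ e) :
    T.RootInv (T.hookPlan σ e l t) := by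
  have hpop : T.Core X σ.pending (pop σ e) := h.congr rfl rfl
  have hl' : T.Chain F X (pop σ e) (T.entryState e) l t := hl.pop e
  obtain ⟨hcore, htgt, hreach⟩ := addPlan_spec hpop hl' hnd
  have hctrl := hookPlan_ctrl_eq_none_iff (e := e) hl
  have hnone : none ∉ (T.hookPlan σ e l t).pending := by
    rw [hookPlan_pending]
    rintro (⟨h1, h2⟩ | ⟨st, -, o, -, -, h1⟩)
    · cases e with
      | none => exact h2 rfl
      | some mo =>
        obtain ⟨ss, hss, -⟩ := h.entry mo.1 mo.2 he
        simp [hroot.empty h1] at hss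
    · cases h1
  refine ⟨fun hn => absurd hn hnone, fun _ => ?_⟩
  cases e with
  | none =>
    have hempty := hroot.empty he
    refine ⟨firstRef l t, rfl, ?_, fun n hn => ?_⟩
    · cases l with
      | nil =>
        obtain ⟨p, hp, hs, -⟩ := hl
        rcases cond_node_eq hp with ⟨rfl, rfl⟩ | ⟨k, ss, -, hk, -⟩
        · exact .inl ⟨rfl, hs⟩
        · simp [hempty] at hk
      | cons st l =>
        have hst : st.state = T.init := hl.1
        exact .inr ⟨congrArg _ hst, by simp [hctrl, hst]⟩
    · have hmem : n ∈ l.map PlanStep.state := by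
        by_contra hmem
        exact hn ((hctrl n).2 ⟨hempty n, hmem⟩)
      exact Edge.mono (fun n ss hn => ⟨ss, hn, fun _ _ => id⟩) (hreach n hmem)
  | some mo =>
    obtain ⟨m, o⟩ := mo
    obtain ⟨ss, hss, -, hno⟩ := h.entry m o he
    obtain ⟨r, hr, hr', hall⟩ := hroot.root fun hn => by simp [hroot.empty hn] at hss
    have hold : ∀ n, σ.ctrl n ≠ none → (T.addPlan (pop σ (some (m, o))) l t).ctrl n = σ.ctrl n :=
      fun n hn => addPlan_ctrl_of_notMem t fun hmem => hn (addPlan_ctrl_of_mem hl' hmem).1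
    have hm := (hold m (by simp [hss])).trans hss
    have hext := link_ext (m := m) (o := o) (firstRef l t) fun ss' hss' => by
      cases hm.symm.trans hss'
      exact hno
    have hold' : ∀ n, σ.ctrl n ≠ none → Reach (T.hookPlan σ (some (m, o)) l t) r (.node n) := by
      intro n hn
      refine Edge.mono (fun k ss' hk => hext k ss' ?_) (hall n hn)
      rw [hold k (by simp [hk]), hk]
    refine ⟨r, ?_, hr'.imp_right fun h => ⟨h.1, fun hn => h.2 ((hctrl _).1 hn).1⟩, fun n hn => ?_⟩
    · exact (link_root ..).trans ((addPlan_root l t).trans hr)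
    by_cases hmem : n ∈ l.map PlanStep.state
    · have hnp : ¬ (m ∈ (T.addPlan (pop σ (some (m, o))) l t).poisoned ∨
          IsPoisoned (T.addPlan (pop σ (some (m, o))) l t) (firstRef l t)) := by
        cases l with
        | nil => simp at hmem
        | cons st l =>
          obtain ⟨heq, hst, -⟩ := hl
          rw [← heq] at hst
          rw [addPlan_poisoned]
          rintro (hp | hp)
          · exact hc (by simp) ⟨m, o, rfl, hp⟩
          · simp only [firstRef, IsPoisoned, addPlan_poisoned] at hp
            exact h.poisoned_ctrl _ hp hst
      have hlink : (T.hookPlan σ (some (m, o)) l t).ctrl m =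
          some { ss with out := Function.update ss.out o (some (firstRef l t)) } := by
        change (link _ m o (firstRef l t)).ctrl m = _
        rw [link_of_not_poisoned hnp]
        simp [hm]
      exact ((hold' m (by simp [hss])).tail ⟨m, _, o, rfl, hlink, by simp⟩).trans
        (Edge.mono hext (hreach n hmem))
    · exact hold' n fun h0 => hn ((hctrl n).2 ⟨h0, hmem⟩)

theorem RootInv.congr (h : T.RootInv σ) (hr : σ'.root = σ.root) (hp : σ'.pending = σ.pending)
    (hc : ∀ n, (σ'.ctrl n).map (fun ss => (ss.act, ss.out)) =
      (σ.ctrl n).map (fun ss => (ss.act, ss.out))) : T.RootInv σ' := by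
  have hnone : ∀ n, σ'.ctrl n = none ↔ σ.ctrl n = none := fun n => by
    rw [← Option.map_eq_none_iff, hc n, Option.map_eq_none_iff]
  refine ⟨fun hn n => (hnone n).2 (h.empty (hp ▸ hn) n), fun hn => ?_⟩
  obtain ⟨r, h1, h2, h3⟩ := h.root (hp ▸ hn)
  refine ⟨r, hr.trans h1, h2.imp_right fun h => ⟨h.1, fun hn => h.2 ((hnone _).1 hn)⟩,
    fun n hn => Edge.mono (fun k ss hk => ?_) (h3 n fun h0 => hn ((hnone n).2 h0))⟩
  have hck := hc k
  rw [hk, Option.map_some] at hck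
  obtain ⟨ss', hss', heq⟩ := Option.map_eq_some_iff.1 hck
  exact ⟨ss', hss', fun o r' ho => by rw [(Prod.mk.inj heq).2, ho]⟩

theorem Inv.hookPlan_fpr (h : T.Inv σ) (he : e ∈ σ.pending) {l : List (PlanStep V D A)}
    {t : Ref V D} (hl : T.Chain F (T.marked σ) σ (T.entryState e) l t)
    (hnd : (l.map PlanStep.state).Nodup) (hc : l ≠ [] → ¬ Case1 σ e)
    (hf : T.Fpr (T.hookPlan σ e l t) σ') : T.Inv σ' := by
  obtain ⟨h1, h2, h3, -, h5⟩ := FprSteps.spec (h.core.hookPlan he hl hnd) hf.1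
  refine ⟨?_, hf.2, (h.rootInv.hookPlan h.core he hl hnd hc).congr h2 h3 h5⟩
  rw [h3]
  exact h1.to_marked hf.2

theorem exists_fprStep_of_poisoned_subset (hc : σ'.ctrl = σ.ctrl)
    (hp : σ.poisoned ⊆ σ'.poisoned) {τ : Solution V D A} (h : T.FprStep σ' τ) :
    ∃ τ', T.FprStep σ τ' := by
  obtain ⟨n, ss, o, r, p, hss, ho, hr, hn, hpr, hne, -⟩ := h
  rw [hc] at hss
  rw [cond_congr (σ := σ) T fun n _ => by rw [hc]] at hr
  refine ⟨_, n, ss, o, r, p, hss, ho, hr, fun h => hn (hp h), fun h => hpr ?_, hne, rfl⟩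
  cases r with
  | goal => exact h
  | node k => exact hp h

/-- Search nodes below a poisoned node can be dropped. -/
theorem Inv.pop (h : T.Inv σ) (hc : Case1 σ e) : T.Inv (pop σ e) := by
  obtain ⟨m, o, rfl, hm⟩ := hc
  have hf : ∀ τ, ¬ T.FprStep (Task.pop σ (some (m, o))) τ := fun τ hτ => by
    obtain ⟨τ', hτ'⟩ := exists_fprStep_of_poisoned_subset (σ := σ)
      (σ' := Task.pop σ (some (m, o))) rfl subset_rfl hτ
    exact h.fixed τ' hτ'
  refine ⟨?_, hf, ?_⟩
  · refine Core.to_marked (X := T.marked σ) ?_ hf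
    refine (h.core.mono Set.sdiff_subset fun h0 => ?_).congr rfl rfl
    simp [h0] at hm
  · refine ⟨fun hn => h.rootInv.empty hn.1, fun hn => h.rootInv.root fun h0 => hn ⟨h0, by simp⟩⟩

theorem ctrl_ne_none_of_reflTransGen_child (h : T.Core X Q σ) {m n : State V D}
    (hm : σ.ctrl m ≠ none) (hr : Relation.ReflTransGen (Child σ) m n) : σ.ctrl n ≠ none := by
  induction hr with
  | refl => exact hm
  | tail _ hstep _ =>
    obtain ⟨ss, o, hss, ho⟩ := hstep
    obtain ⟨p, hp, -⟩ := h.target _ ss o _ hss ho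
    obtain ⟨ss', hss', -⟩ := Option.map_eq_some_iff.1 hp
    simp [hss']

/-- Poisoning preserves the invariant: the search node that is dropped remains unhandled. -/
theorem Inv.poison {m : State V D} {o : PState V D} (h : T.Inv σ)
    (he : some (m, o) ∈ σ.pending) :
    T.Inv (poison (Task.pop σ (some (m, o))) (some (m, o))) := by
  have hf : ∀ τ, ¬ T.FprStep (Task.poison (Task.pop σ (some (m, o))) (some (m, o))) τ := by
    intro τ hτ
    obtain ⟨τ', hτ'⟩ := exists_fprStep_of_poisoned_subset (σ := σ)
      (σ' := Task.poison (Task.pop σ (some (m, o))) (some (m, o))) rfl Set.subset_union_left hτ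
    exact h.fixed τ' hτ'
  obtain ⟨ss, hss, ho, hno⟩ := h.core.entry m o he
  have hm : m ∈ (Task.poison (Task.pop σ (some (m, o))) (some (m, o))).poisoned :=
    .inr ⟨m, o, rfl, .refl⟩
  have hne := (Set.nonempty_of_mem hm).ne_empty
  refine ⟨?_, hf, ?_⟩
  · refine Core.to_marked (X := T.marked σ) ?_ hf
    have hc := h.core
    refine ⟨hc.goal_mem, hc.full_of_mem, hc.mem_of_edge, ?_, hc.sat_ps, hc.pre_le, hc.exp_mem,
      hc.out_mem, hc.target, fun n o' h' => hc.entry n o' h'.1, ?_, fun h0 => absurd h0 hne,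
      fun h0 => absurd h0 hne, fun _ => ⟨m, ss, o, hss, ho, hno, fun h' => h'.2 rfl⟩⟩
    · intro n ss' o' r p hn hss' ho' hr hpn hpr
      refine hc.fix_of_mem n ss' o' r p hn hss' ho' hr (fun h0 => hpn (.inl h0)) fun h0 => hpr ?_
      cases r with
      | goal => exact h0
      | node k => exact .inl h0
    · rintro n (hn | ⟨m', o', heq, hn⟩)
      · exact hc.poisoned_ctrl n hn
      · cases heq
        exact ctrl_ne_none_of_reflTransGen_child (hc.congr (σ' := Task.pop σ (some (m, o))) rfl rfl)
          (by simp [Task.pop, hss]) hn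
  · exact ⟨fun hn => h.rootInv.empty hn.1, fun hn => h.rootInv.root fun h0 => hn ⟨h0, by simp⟩⟩

/-! ### Handling a search node -/

theorem Follows.chain (h : T.Core X Q σ) {r t : Ref V D} {s : State V D}
    {l : List (PlanStep V D A)} (hf : T.Follows F σ r s l t) : T.Chain F X σ s l t := by
  induction hf with
  | goal r s hs => exact ⟨T.goal, rfl, hs, .inr h.goal_mem⟩
  | known r s _ hs =>
    obtain ⟨ss, hss⟩ := Option.ne_none_iff_exists'.1 hs
    exact ⟨ss.ps, by simp [cond, hss], h.sat_ps s ss hss, .inl rfl⟩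
  | step n s ss r t l _ hs hn _ _ hpre hforb _ _ ih =>
    exact ⟨rfl, hs, hpre, hforb, h.exp_mem n ss hn, ih⟩

theorem Stops.chain (h : T.Core X Q σ) {t : Ref V D} {s : State V D}
    {l : List (PlanStep V D A)} (hs : T.Stops F σ s l t) :
    T.Chain F X σ s l t ∧ (l.map PlanStep.state).Nodup := by
  rcases hs with ⟨hs, rfl, rfl⟩ | ⟨r, -, -, hf, hnd⟩
  · obtain ⟨ss, hss⟩ := Option.ne_none_iff_exists'.1 hs
    exact ⟨⟨ss.ps, by simp [cond, hss], h.sat_ps s ss hss, .inl rfl⟩, by simp⟩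
  · exact ⟨hf.chain h, hnd⟩

/-- The search would also have stopped in every state of a path that the controller embodies. -/
theorem Follows.exists_stops {r t : Ref V D} {s x : State V D} {l : List (PlanStep V D A)}
    (hf : T.Follows F σ r s l t) (hnd : (l.map PlanStep.state).Nodup)
    (hx : x ∈ l.map PlanStep.state) : ∃ l' t', T.Stops F σ x l' t' := by
  induction hf with
  | goal => simp at hx
  | known => simp at hx
  | step n s ss r t l h1 h2 h3 h4 h5 h6 h7 h8 h9 ih =>
    rw [List.map_cons, List.mem_cons] at hx
    rcases hx with rfl | hx
    · exact ⟨_, t, .inr ⟨.node n, ⟨ss.ps, by simp [cond, h3], h5⟩, h4,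
        .step n _ ss r t l h1 h2 h3 h4 h5 h6 h7 h8 h9, hnd⟩⟩
    · exact ih (List.nodup_cons.1 hnd).2 hx

theorem Search.not_stops {s e x : State V D} {l : List (PlanStep V D A)}
    (h : T.Search F σ s l e) (hx : x ∈ l.map PlanStep.state) :
    ¬ ∃ l' t, T.Stops F σ x l' t := by
  induction h with
  | nil => simp at hx
  | cons s e a o l h1 _ _ _ _ ih =>
    rw [List.map_cons, List.mem_cons] at hx
    rcases hx with rfl | hx
    · exact h1
    · exact ih hx

theorem Search.chain_append {s e : State V D} {l₁ l₂ : List (PlanStep V D A)} {t : Ref V D}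
    (h : T.Search F σ s l₁ e) (hl : T.Chain F X σ e l₂ t) : T.Chain F X σ s (l₁ ++ l₂) t := by
  induction h with
  | nil => exact hl
  | cons s e a o l h1 h2 h3 h4 _ ih =>
    refine ⟨rfl, ?_, h2, h3, h4, ih hl⟩
    by_contra hs
    exact h1 ⟨[], _, .inl ⟨hs, rfl, rfl⟩⟩

theorem WeakPlan.chain (h : T.Core X Q σ) {t : Ref V D} {s : State V D}
    {l : List (PlanStep V D A)} (hw : T.WeakPlan F σ s l t) :
    T.Chain F X σ s l t ∧ (l.map PlanStep.state).Nodup := by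
  obtain ⟨l₁, l₂, e, hs, hnd, hst, rfl⟩ := hw
  obtain ⟨hch, hnd₂⟩ := hst.chain h
  refine ⟨hs.chain_append hch, ?_⟩
  rw [List.map_append, List.nodup_append']
  refine ⟨hnd, hnd₂, fun x hx₁ hx₂ => hs.not_stops hx₁ ?_⟩
  rcases hst with ⟨-, rfl, -⟩ | ⟨r, -, -, hf, -⟩
  · simp at hx₂
  · exact hf.exists_stops hnd₂ hx₂

theorem Case0.chain {r : Ref V D} (h : T.Case0 σ e r) :
    T.Chain F (T.marked σ) σ (T.entryState e) [] r := by
  obtain ⟨hm, p, hp, hs⟩ := h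
  exact ⟨p, hp, hs, .inr hm⟩

theorem Case2.chain (h : T.Core X Q σ) (hc : T.Case2 σ e) :
    T.Chain F X σ (T.entryState e) [] (.node (T.entryState e)) := by
  obtain ⟨ss, hss⟩ := Option.ne_none_iff_exists'.1 hc
  exact ⟨ss.ps, by simp [cond, hss], h.sat_ps _ ss hss, .inl rfl⟩

theorem Case4.chain (h : T.Core X Q σ) {l : List (PlanStep V D A)} {t : Ref V D}
    (hc : T.Case4 F σ e l t) :
    T.Chain F X σ (T.entryState e) l t ∧ (l.map PlanStep.state).Nodup :=
  Stops.chain h (.inr hc)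

theorem Case3.case4 {l : List (PlanStep V D A)} {t : Ref V D} (hc : T.Case3 F σ e l t) :
    T.Case4 F σ e l t := by
  obtain ⟨m, o, ss, n, ss', r, -, -, -, -, -, h⟩ := hc
  exact ⟨r, h⟩

/-- The cases 0 and 2 to 5 all add a weak plan, an empty one in the cases 0 and 2. -/
theorem Handle.cases (h : T.Inv σ) (hh : T.Handle e F σ F' σ') :
    (F' = F ∧ ∃ l t, T.Chain F (T.marked σ) σ (T.entryState e) l t ∧
      (l.map PlanStep.state).Nodup ∧ (l ≠ [] → ¬ Case1 σ e) ∧ T.Fpr (T.hookPlan σ e l t) σ') ∨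
    (F' = F ∧ Case1 σ e ∧ σ' = Task.pop σ e) ∨
    (∃ x de, T.Deadend F σ x ∧ T.Generalizes x de ∧ ¬ T.fsaps de ⊆ F ∧
      F' = F ∪ T.fsaps de ∧ σ' = σ) ∨
    ∃ de, T.Deadend F σ (T.entryState e) ∧ T.Generalizes (T.entryState e) de ∧
      F' = F ∪ T.fsaps de ∧ T.Case6 F σ e ∧ σ' = Task.poison (Task.pop σ e) e := by
  cases hh with
  | case0 _ r h0 hf => exact .inl ⟨rfl, [], r, h0.chain, by simp, by simp, hf⟩
  | case1 _ hc => exact .inr (.inl ⟨rfl, hc, rfl⟩)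
  | case2 _ _ _ h2 hf => exact .inl ⟨rfl, [], _, h2.chain h.core, by simp, by simp, hf⟩
  | case3 _ l t hn h3 hf =>
    obtain ⟨h4, h5⟩ := h3.case4.chain h.core
    exact .inl ⟨rfl, l, t, h4, h5, fun _ => hn.2.1, hf⟩
  | case4 _ l t hn _ h4 hf =>
    obtain ⟨h4, h5⟩ := h4.chain h.core
    exact .inl ⟨rfl, l, t, h4, h5, fun _ => hn.2.1, hf⟩
  | case5 _ l t hn h5 hf =>
    obtain ⟨h4, h5⟩ := WeakPlan.chain h.core h5
    exact .inl ⟨rfl, l, t, h4, h5, fun _ => hn.1.2.1, hf⟩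
  | record x de _ _ _ hd hg hF => exact .inr (.inr (.inl ⟨x, de, hd, hg, hF, rfl, rfl⟩))
  | case6 de hn hd hg => exact .inr (.inr (.inr ⟨de, hd, hg, rfl, ⟨hn, hd⟩, rfl⟩))

/-- The inner loop does not get stuck. -/
theorem Inv.exists_handle [Finite V] [∀ x, Finite (D x)] (h : T.Inv σ) (he : e ∈ σ.pending)
    (F : Set (PState V D × A)) : ∃ F' σ', T.Handle e F σ F' σ' := by
  have hfpr : ∀ {l t}, T.Chain F (T.marked σ) σ (T.entryState e) l t ∧
      (l.map PlanStep.state).Nodup → ∃ σ', T.Fpr (T.hookPlan σ e l t) σ' := fun hl =>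
    exists_fpr (h.core.hookPlan he hl.1 hl.2)
  by_cases h0 : ∃ r, T.Case0 σ e r
  · obtain ⟨r, h0⟩ := h0
    obtain ⟨σ', hσ'⟩ := hfpr ⟨h0.chain, by simp⟩
    exact ⟨F, σ', .case0 F σ σ' r h0 hσ'⟩
  by_cases h1 : Case1 σ e
  · exact ⟨F, _, .case1 F σ h0 h1⟩
  by_cases h2 : T.Case2 σ e
  · obtain ⟨σ', hσ'⟩ := hfpr ⟨h2.chain h.core, by simp⟩
    exact ⟨F, σ', .case2 F σ σ' h0 h1 h2 hσ'⟩
  by_cases h3 : ∃ l t, T.Case3 F σ e l t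
  · obtain ⟨l, t, h3⟩ := h3
    obtain ⟨σ', hσ'⟩ := hfpr (h3.case4.chain h.core)
    exact ⟨F, σ', .case3 F σ σ' l t ⟨h0, h1, h2⟩ h3 hσ'⟩
  by_cases h4 : ∃ l t, T.Case4 F σ e l t
  · obtain ⟨l, t, h4⟩ := h4
    obtain ⟨σ', hσ'⟩ := hfpr (h4.chain h.core)
    exact ⟨F, σ', .case4 F σ σ' l t ⟨h0, h1, h2⟩ h3 h4 hσ'⟩
  by_cases h5 : ∃ l t, T.Case5 F σ e l t
  · obtain ⟨l, t, h5⟩ := h5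
    obtain ⟨σ', hσ'⟩ := hfpr (WeakPlan.chain h.core h5)
    exact ⟨F, σ', .case5 F σ σ' l t ⟨⟨h0, h1, h2⟩, h3, h4⟩ h5 hσ'⟩
  · obtain ⟨de, hde⟩ := T.exists_generalizes (T.entryState e)
    exact ⟨_, _, .case6 F σ de ⟨⟨h0, h1, h2⟩, h3, h4⟩ h5 hde⟩

/-- In case 6 the search node has a predecessor, unless the initial state is a deadend. -/
theorem Handle.inv (h : T.Inv σ) (he : e ∈ σ.pending) (hh : T.Handle e F σ F' σ')
    (h6 : ¬ (T.Case6 F σ e ∧ T.entryState e = T.init)) : T.Inv σ' := by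
  rcases hh.cases h with ⟨-, l, t, hl, hnd, hc, hf⟩ | ⟨-, hc, rfl⟩ | ⟨x, de, -, -, -, -, rfl⟩ |
    ⟨de, -, -, -, hc, rfl⟩
  · exact h.hookPlan_fpr he hl hnd hc hf
  · exact h.pop hc
  · exact h
  · cases e with
    | none => exact absurd ⟨hc, rfl⟩ h6
    | some mo => exact h.poison he

theorem Handle.sound {π : State V D → Option A} (hπ : T.IsStrongCyclic π) (hF : T.Sound π F)
    (h : T.Inv σ) (hh : T.Handle e F σ F' σ') : T.Sound π F' := by
  rcases hh.cases h with ⟨rfl, -⟩ | ⟨rfl, -⟩ | ⟨x, de, hx, hde, -, rfl, -⟩ | ⟨de, hx, hde, rfl, -⟩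
  · exact hF
  · exact hF
  · exact hF.union_fsaps hπ hx hde
  · exact hF.union_fsaps hπ hx hde

/-! ### Termination -/

/-- So far no node has been poisoned, and the controller uses no forbidden action. A round whose
forbidden pairs do not change preserves this. -/
def Clean (F : Set (PState V D × A)) (σ : Solution V D A) : Prop :=
  σ.poisoned = ∅ ∧ ∀ n ss, σ.ctrl n = some ss → ¬ Forbidden F n ss.act

theorem Inv.detectedSC_of_poisoned_eq_empty (h : T.Inv σ) (hp : σ.pending = ∅)
    (hc : σ.poisoned = ∅) : T.DetectedSC σ := by
  have hsc : ∀ r, ¬ T.NotSC σ r := by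
    intro r hr
    induction hr with
    | unhandled n ss o hn ho hno => simpa [hp] using h.core.full hc n ss o hn ho hno
    | pred _ _ _ _ _ _ _ ih => exact ih
  obtain ⟨r, hr, hr', -⟩ := h.rootInv.root (by simp [hp])
  refine ⟨r, hr, ?_, hsc r⟩
  rcases hr' with ⟨rfl, -⟩ | ⟨rfl, hn⟩
  · rfl
  · simpa [cond, Option.isSome_iff_ne_none] using hn

/-- As long as the forbidden pairs do not change, the controller grows or a search node is
removed. A clean solution meets no deadend then, since recording it makes the action forbidden that
led to it. -/
theorem Handle.progress (h : T.Inv σ) (he : e ∈ σ.pending) (hh : T.Handle e F σ F' σ')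
    (h6 : ¬ (T.Case6 F σ e ∧ T.entryState e = T.init)) :
    F ⊂ F' ∨ F' = F ∧ (Clean F σ → Clean F σ') ∧
      ({n | σ'.ctrl n = none} ⊂ {n | σ.ctrl n = none} ∨
        {n | σ'.ctrl n = none} = {n | σ.ctrl n = none} ∧ σ'.pending ⊂ σ.pending) := by
  have hpop : σ.pending \ {e} ⊂ σ.pending := Set.sdiff_singleton_ssubset.2 he
  rcases hh.cases h with ⟨rfl, l, t, hl, hnd, hc, hf⟩ | ⟨rfl, hc, rfl⟩ |
    ⟨x, de, -, -, hsub, rfl, rfl⟩ | ⟨de, -, hde, rfl, hc, rfl⟩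
  · refine .inr ⟨rfl, ?_, ?_⟩
    · intro ⟨hp, hcl⟩
      obtain ⟨-, -, -, h4, h5⟩ := FprSteps.spec (h.core.hookPlan he hl hnd) hf.1
      refine ⟨by rw [h4, hookPlan_poisoned, hp], fun n ss hn => ?_⟩
      have hcn := h5 n
      rw [hn, Option.map_some, eq_comm] at hcn
      obtain ⟨ss', hss', heq⟩ := Option.map_eq_some_iff.1 hcn
      rw [← (Prod.mk.inj heq).1]
      exact hookPlan_not_forbidden hl hcl n ss' hss'
    · obtain ⟨-, -, h3, -, h5⟩ := FprSteps.spec (h.core.hookPlan he hl hnd) hf.1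
      have hnone : ∀ n, σ'.ctrl n = none ↔ σ.ctrl n = none ∧ n ∉ l.map PlanStep.state := fun n => by
        rw [← Option.map_eq_none_iff, h5 n, Option.map_eq_none_iff, hookPlan_ctrl_eq_none_iff hl]
      cases l with
      | nil =>
        refine .inr ⟨by simp [hnone], ?_⟩
        rw [h3, hookPlan_pending]
        simpa [planEntries] using hpop
      | cons st l =>
        refine .inl ((Set.ssubset_iff_of_subset fun n hn => ((hnone n).1 hn).1).2
          ⟨st.state, hl.1 ▸ hl.2.1, fun hn => ((hnone _).1 hn).2 (by simp)⟩)
  · exact .inr ⟨rfl, id, .inr ⟨rfl, hpop⟩⟩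
  · exact .inl (Set.ssubset_iff_subset_ne.2 ⟨Set.subset_union_left, fun heq => hsub (by
      rw [heq]; exact Set.subset_union_right)⟩)
  · by_cases heq : F ∪ T.fsaps de = F
    · refine .inr ⟨heq, fun hcl => ?_, .inr ⟨rfl, hpop⟩⟩
      cases e with
      | none => exact absurd ⟨hc, rfl⟩ h6
      | some mo =>
        obtain ⟨ss, hss, ho, -⟩ := h.core.entry mo.1 mo.2 he
        obtain ⟨ps, hps, hsat⟩ := T.forbidden_fsaps (h.core.sat_pre hss) ho hde.sat
        exact absurd ⟨ps, heq ▸ .inr hps, hsat⟩ (hcl.2 _ ss hss)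
    · exact .inl (Set.ssubset_iff_subset_ne.2 ⟨Set.subset_union_left, Ne.symm heq⟩)

/-! ### The policy of a strong cyclic controller -/

theorem NotSC.of_reach {r r' : Ref V D} (h : Reach σ r r') (hr : T.NotSC σ r') : T.NotSC σ r := by
  induction h using Relation.ReflTransGen.head_induction_on with
  | refl => exact hr
  | head hstep _ ih =>
    obtain ⟨n, ss, o, rfl, hn, ho⟩ := hstep
    exact .pred n ss o _ hn ho ih

theorem exists_goalIn_of_reach {r : Ref V D} (h : Reach σ r .goal) : ∃ k, GoalIn σ r k := by
  induction h using Relation.ReflTransGen.head_induction_on with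
  | refl => exact ⟨0, .zero⟩
  | head hstep _ ih =>
    obtain ⟨n, ss, o, rfl, hn, ho⟩ := hstep
    obtain ⟨k, hk⟩ := ih
    exact ⟨k + 1, .succ n ss o _ k hn ho hk⟩

theorem exists_isPolicyOf (T : Task V D A) (σ : Solution V D A) : ∃ π, T.IsPolicyOf σ π := by
  have key : ∀ s, ∃ a, (∃ r, T.Closest σ s r ∧ a = refAct σ r) ∨
      ((∀ r, ¬ T.Matches σ r s) ∧ a = none) := by
    intro s
    by_cases hm : ∃ k r, T.Matches σ r s ∧ GoalIn σ r k
    · obtain ⟨r, hr, hk⟩ := Nat.find_spec hm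
      exact ⟨_, .inl ⟨r, ⟨hr, fun r' k' h1 h2 => ⟨_, Nat.find_min' hm ⟨r', h1, h2⟩, hk⟩⟩, rfl⟩⟩
    · by_cases hr : ∃ r, T.Matches σ r s
      · obtain ⟨r, hr⟩ := hr
        exact ⟨_, .inl ⟨r, ⟨hr, fun r' k' h1 h2 => absurd ⟨k', r', h1, h2⟩ hm⟩, rfl⟩⟩
      · exact ⟨none, .inr ⟨fun r h => hr ⟨r, h⟩, rfl⟩⟩
  choose π hπ using key
  exact ⟨π, hπ⟩

/-- A controller without poisoned nodes in which all outcomes are handled is strong cyclic: since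
its conditions are closed under regression, every outcome of the action of a matching node leads to
a state that the successor matches, and one outcome gets closer to the goal. -/
theorem Inv.isStrongCyclic (h : T.Inv σ) (hp : σ.pending = ∅) (hd : T.DetectedSC σ)
    {π : State V D → Option A} (hπ : T.IsPolicyOf σ π) : T.IsStrongCyclic π := by
  obtain ⟨r₀, hr₀, hr₀', hall⟩ := h.rootInv.root (by simp [hp])
  obtain ⟨r₁, hr₁, -, hsc⟩ := hd
  cases hr₀.symm.trans hr₁
  have hfull : ∀ n ss o, σ.ctrl n = some ss → o ∈ T.eff ss.act → ss.out o ≠ none :=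
    fun n ss o hn ho hno => hsc (NotSC.of_reach (hall n (by simp [hn]))
      (.unhandled n ss o hn ho hno))
  -- Poisoning would have left an unhandled outcome.
  have hpois : σ.poisoned = ∅ := by
    by_contra hne
    obtain ⟨n, ss, o, hn, ho, hno, -⟩ := h.core.lost (Set.nonempty_iff_ne_empty.2 hne)
    exact hfull n ss o hn ho hno
  have hgoal : ∀ {r s}, T.Matches σ r s → ∃ k, GoalIn σ r k := by
    rintro r s ⟨p, hr, -⟩
    rcases cond_node_eq hr with ⟨rfl, -⟩ | ⟨n, ss, rfl, hn, -⟩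
    · exact ⟨0, .zero⟩
    · exact exists_goalIn_of_reach (h.core.reach_goal hpois n (by simp [hn]))
  have hsucc : ∀ n ss o r s, σ.ctrl n = some ss → ss.out o = some r → Sat s ss.ps →
      T.Matches σ r (app s o) := by
    intro n ss o r s hn ho hs
    obtain ⟨p, hr, hsp, -⟩ := h.core.target n ss o r hn ho
    have hfix : upd ss.ps (T.regr p ss.act o) = ss.ps := by
      by_contra hne
      exact h.fixed _ ⟨n, ss, o, r, p, hn, ho, hr, by simp [hpois],
        by cases r <;> simp [IsPoisoned, hpois], hne, rfl⟩
    rw [← hfix] at hs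
    exact ⟨p, hr, T.sat_app_of_sat_regr (T.consistent_of_sat_app (h.core.sat_pre hn) hsp)
      hs.of_upd_right⟩
  have hstep : ∀ s r k, ¬ Sat s T.goal → T.Matches σ r s → GoalIn σ r k →
      ∃ a, π s = some a ∧ Sat s (T.pre a) ∧ (∀ o ∈ T.eff a, ∃ r', T.Matches σ r' (app s o)) ∧
        ∃ o ∈ T.eff a, ∃ r' k', k' < k ∧ T.Matches σ r' (app s o) ∧ GoalIn σ r' k' := by
    intro s r k hng hm hk
    -- The policy uses a matching node `c` that is at most `k` edges away from the goal node.
    rcases hπ s with ⟨c, ⟨⟨p, hcp, hs⟩, hmin⟩, hact⟩ | ⟨hno, -⟩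
    · obtain ⟨k₀, hk₀, hgi⟩ := hmin r k hm hk
      cases hgi with
      | zero =>
        cases hcp
        exact absurd hs hng
      | succ n ss o r' k' hn ho hgi =>
        rw [cond, hn] at hcp
        cases hcp
        rw [refAct, hn] at hact
        refine ⟨ss.act, hact, ?_, fun o' ho' => ?_, o, h.core.out_mem n ss o r' hn ho, r', k',
          by omega, hsucc n ss o r' s hn ho hs, hgi⟩
        · exact sat_iff.2 fun x d hx => sat_iff.1 hs x d (h.core.pre_le n ss hn x d hx)
        · obtain ⟨r'', hr''⟩ := Option.ne_none_iff_exists'.1 (hfull n ss o' hn ho')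
          exact ⟨r'', hsucc n ss o' r'' s hn hr'' hs⟩
    · exact absurd hm (hno r)
  intro s hs
  have hmatch : ∃ r, T.Matches σ r s := by
    induction hs with
    | refl =>
      rcases hr₀' with ⟨-, hg⟩ | ⟨-, hn⟩
      · exact ⟨.goal, T.goal, rfl, hg⟩
      · obtain ⟨ss, hss⟩ := Option.ne_none_iff_exists'.1 hn
        exact ⟨.node T.init, ss.ps, by simp [cond, hss], h.core.sat_ps _ ss hss⟩
    | tail _ hst ih =>
      obtain ⟨r, hr⟩ := ih
      obtain ⟨hng, a, ha, -, o, ho, rfl⟩ := hst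
      obtain ⟨k, hk⟩ := hgoal hr
      obtain ⟨a', ha', -, hall', -⟩ := hstep _ r k hng hr hk
      cases ha.symm.trans ha'
      exact hall' o ho
  obtain ⟨r, hr⟩ := hmatch
  obtain ⟨k, hk⟩ := hgoal hr
  refine ⟨fun hng => ?_, ?_⟩
  · obtain ⟨a, ha, hpre, -⟩ := hstep s r k hng hr hk
    exact ⟨a, ha, hpre⟩
  · clear hs
    induction k using Nat.strong_induction_on generalizing s r with
    | _ k ih =>
      by_cases hng : Sat s T.goal
      · exact ⟨s, .refl, hng⟩
      obtain ⟨a, ha, hpre, -, o, ho, r', k', hlt, hr', hk'⟩ := hstep s r k hng hr hk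
      obtain ⟨g, hg, hgoal⟩ := ih k' hlt (app s o) r' hr' hk'
      exact ⟨g, .head ⟨hng, a, ha, hpre, o, ho, rfl⟩ hg, hgoal⟩

/-! ### Runs of the planner -/

/-- The invariant of the planner, where `π` is some strong cyclic plan. -/
def ConfigInv (T : Task V D A) (π : State V D → Option A) : Config V D A → Prop
  | .outer inc F => T.Sound π F ∧ (T.DetectedSC inc → T.Inv inc ∧ inc.pending = ∅)
  | .inner inc F σ => T.Sound π F ∧ ¬ T.DetectedSC inc ∧ T.Inv σ
  | .done π' => T.IsStrongCyclic π'

theorem configInv_start (T : Task V D A) (π : State V D → Option A) : T.ConfigInv π start := by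
  refine ⟨fun s _ _ a _ ⟨ps, hps, _⟩ => hps, ?_⟩
  rintro ⟨r, hr, -⟩
  cases hr

/-- The initial state is never a deadend. -/
theorem Sound.not_case6 {π : State V D → Option A} (hπ : T.IsStrongCyclic π)
    (hF : T.Sound π F) (he : T.entryState e = T.init) : ¬ T.Case6 F σ e := by
  rintro ⟨-, hd⟩
  obtain ⟨-, g, hg, hgoal⟩ := hπ T.init .refl
  exact T.not_deadend σ hF .refl hg hgoal (he ▸ hd)

theorem PR2Step.configInv {π : State V D → Option A} (hπ : T.IsStrongCyclic π)
    {c c' : Config V D A} (hc : T.ConfigInv π c) (h : T.PR2Step c c') : T.ConfigInv π c' := by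
  cases h with
  | finish inc F π' hd hp =>
    obtain ⟨hi, hp'⟩ := hc.2 hd
    exact hi.isStrongCyclic hp' hd hp
  | round inc F hd => exact ⟨hc.1, hd, T.inv_emptySol⟩
  | handle inc σ σ' F F' e he hh h6 =>
    exact ⟨hh.sound hπ hc.1 hc.2.2, hc.2.1, hh.inv hc.2.2 he h6⟩
  | fail inc σ F e π' he h6 heq hp => exact absurd h6 (hc.1.not_case6 hπ heq)
  | accept inc σ F hp hd => exact ⟨hc.1, fun _ => ⟨hc.2.2, hp⟩⟩
  | replace inc σ F hp hd => exact ⟨hc.1, fun hd' => absurd hd' hd⟩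
  | keep inc σ F hp hd => exact ⟨hc.1, fun hd' => absurd hd' hc.2.1⟩

/-- The planner stops only by returning a policy. -/
theorem ConfigInv.exists_step [Finite V] [∀ x, Finite (D x)] {π : State V D → Option A}
    (hπ : T.IsStrongCyclic π) {c : Config V D A} (hc : T.ConfigInv π c) (hd : ∀ π', c ≠ .done π') :
    ∃ c', T.PR2Step c c' := by
  cases c with
  | done π' => exact absurd rfl (hd π')
  | outer inc F =>
    by_cases h : T.DetectedSC inc
    · obtain ⟨π', hπ'⟩ := T.exists_isPolicyOf inc
      exact ⟨_, .finish inc F π' h hπ'⟩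
    · exact ⟨_, .round inc F h⟩
  | inner inc F σ =>
    by_cases hp : σ.pending = ∅
    · by_cases h : T.DetectedSC σ
      · exact ⟨_, .accept inc σ F hp h⟩
      · exact ⟨_, .replace inc σ F hp h⟩
    · obtain ⟨e, he⟩ := Set.nonempty_iff_ne_empty.2 hp
      obtain ⟨F', σ', hh⟩ := hc.2.2.exists_handle he F
      exact ⟨_, .handle inc σ σ' F F' e he hh fun h => hc.1.not_case6 hπ h.2 h.1⟩

/-- The termination measure. Until the planner stops, the first component only changes when
forbidden pairs are recorded. The second one orders the phases between two such events, in
decreasing order: the rest of a round in which pairs were recorded, the head of the outer loop,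
a clean round, and a detected solution. The last two components decrease within a round. -/
noncomputable def rank (T : Task V D A) : Config V D A → ℕ ×ₗ ℕ ×ₗ ℕ ×ₗ ℕ
  | .outer inc F => toLex (Set.ncard Fᶜ, toLex (if T.DetectedSC inc then 1 else 3, toLex (0, 0)))
  | .inner _ F σ => toLex (Set.ncard Fᶜ, toLex (if Clean F σ then 2 else 4,
      toLex (Set.ncard {n | σ.ctrl n = none}, σ.pending.ncard)))
  | .done _ => toLex (0, toLex (0, toLex (0, 0)))

theorem PR2Step.rank_lt [Finite V] [∀ x, Finite (D x)] [Finite A] {π : State V D → Option A}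
    {c c' : Config V D A} (hc : T.ConfigInv π c) (h : T.PR2Step c c') : T.rank c' < T.rank c := by
  have hdirty : ∀ {σ F}, T.Inv σ → σ.pending = ∅ → ¬ T.DetectedSC σ → ¬ Clean F σ :=
    fun hi hp hd hcl => hd (hi.detectedSC_of_poisoned_eq_empty hp hcl.1)
  cases h with
  | finish inc F π' hd hp =>
    simp [rank, Prod.Lex.toLex_lt_toLex, hd]
    omega
  | round inc F hd =>
    have hcl : Clean F (emptySol {none} : Solution V D A) :=
      ⟨rfl, fun n ss h => by cases h⟩
    simp [rank, Prod.Lex.toLex_lt_toLex, hd, hcl]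
  | handle inc σ σ' F F' e he hh h6 =>
    simp only [rank, Prod.Lex.toLex_lt_toLex]
    rcases hh.progress hc.2.2 he h6 with hlt | ⟨rfl, hcl, hprog⟩
    · exact .inl (Set.ncard_lt_ncard (compl_lt_compl_iff_lt.2 hlt))
    refine .inr ⟨rfl, ?_⟩
    have hlast : Set.ncard {n | σ'.ctrl n = none} < Set.ncard {n | σ.ctrl n = none} ∨
        Set.ncard {n | σ'.ctrl n = none} = Set.ncard {n | σ.ctrl n = none} ∧
          σ'.pending.ncard < σ.pending.ncard :=
      hprog.imp (fun h => Set.ncard_lt_ncard h)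
        fun h => ⟨by rw [h.1], Set.ncard_lt_ncard h.2⟩
    by_cases h1 : Clean F' σ
    · simpa [h1, hcl h1] using hlast
    · by_cases h2 : Clean F' σ'
      · simp [h1, h2]
      · simpa [h1, h2] using hlast
  | fail inc σ F e π' he h6 heq hp =>
    simp only [rank, Prod.Lex.toLex_lt_toLex]
    split_ifs <;> simp <;> omega
  | accept inc σ F hp hd =>
    simp only [rank, Prod.Lex.toLex_lt_toLex, hd, if_true]
    split_ifs <;> simp
  | replace inc σ F hp hd =>
    simp [rank, Prod.Lex.toLex_lt_toLex, hd, hdirty hc.2.2 hp hd]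
  | keep inc σ F hp hd =>
    simp [rank, Prod.Lex.toLex_lt_toLex, hc.2.1, hdirty hc.2.2 hp hd]

end Task

end FOND

theorem mainTheorem2 {V : Type*} [Finite V] {D : V → Type*} [∀ x, Finite (D x)]
    {A : Type*} [Finite A] (T : FOND.Task V D A)
    (hT : ∃ π, T.IsStrongCyclic π) :
    (¬ ∃ run : ℕ → FOND.Config V D A,
      run 0 = FOND.Task.start ∧ ∀ i, T.PR2Step (run i) (run (i + 1))) ∧
    ∀ c, Relation.ReflTransGen T.PR2Step FOND.Task.start c → (∀ c', ¬ T.PR2Step c c') →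
      ∃ π, c = .done π ∧ T.IsStrongCyclic π := by
  obtain ⟨π, hπ⟩ := hT
  constructor
  · rintro ⟨run, h0, hrun⟩
    have hinv : ∀ i, T.ConfigInv π (run i) := by
      intro i
      induction i with
      | zero => exact h0 ▸ T.configInv_start π
      | succ i ih => exact (hrun i).configInv hπ ih
    exact not_strictAnti_of_wellFoundedLT (fun i => T.rank (run i))
      (strictAnti_nat_of_succ_lt fun i => (hrun i).rank_lt (hinv i))
  · intro c hc hstuck
    have hinv : T.ConfigInv π c := by
      clear hstuck
      induction hc with
      | refl => exact T.configInv_start π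
      | tail _ hstep ih => exact hstep.configInv hπ ih
    by_cases hd : ∃ π', c = .done π'
    · obtain ⟨π', rfl⟩ := hd
      exact ⟨π', rfl, hinv⟩
    · obtain ⟨c', hc'⟩ := hinv.exists_step hπ fun π' h => hd ⟨π', h⟩
      exact absurd hc' (hstuck c')
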